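/- Let $P$ be a smooth manifold, $S\subset P$ an embedded submanifold carrying a symplectic form $\omega$, and $\mathcal N\subset P$ a tubular neighborhood of $S$, i.e. an open set containing $S$ which is identified with (an open neighborhood of the zero section in) the total space of a smooth vector bundle over $S$, with $S$ as the zero section. Let $p:\mathcal N\to S$ be the projection and $\mathrm{Vert}=\ker p_*$. Let $(\Gamma,\nu,\varphi)$ be geometric data on $\mathcal N$, that is: - an Ehresmann connection $\Gamma$, i.e. a smooth projection $\Gamma:T\mathcal N\to \mathrm{Vert}$; put $\mathrm{Hor}=\ker\Gamma$, let $\overline X$ denote the horizontal lift to $\mathcal N$ of a vector field $X\in\chi(S)$ (the section of $\mathrm{Hor}$ with $p_*\overline X=X$), and let $Curv_\Gamma(X,Y)=[\overline X,\overline Y]-\overline{[X,Y]}$; - a smooth vertical bivector field $\nu\in\Gamma(\Lambda^2\mathrm{Vert})$; - a nondegenerate $2$-form $\varphi\in\Omega^2(S)\otimes C^\infty(\mathcal N)$, i.e. a smooth family of nondegenerate alternating forms $\varphi_x$ on $T_{p(x)}S$, $x\in\mathcal N$, with $\varphi_x=\omega_x$ for $x\in S$. Let $\widehat\omega=p^*\varphi\in\Omega^2(\mathcal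 N)$ be the coupling form, $\widehat\omega_x(u,v)=\varphi_x(p_*u,p_*v)$. For a bivector $\Lambda$ write $\Lambda\alpha=\Lambda(\alpha,\cdot)$. Let $\mu=\widehat\omega|_{Hor}^{-1}$ be the horizontal coupling bivector: for a covector $\alpha$ at $x$, $\mu\alpha\in\mathrm{Hor}_x$ is the vector with $\widehat\omega(\mu\alpha,v)=\alpha(v)$ for all $v\in \mathrm{Hor}_x$. Then $\pi=\mu+\nu$ is a Poisson bivector field (a smooth bivector field with $[\pi,\pi]=0$) if and only if the following four conditions hold: 1. $\nu$ is a Poisson bivector field, i.e. $[\nu,\nu]=0$; 2. $[\overline X,\nu]=0$ for all $X\in\chi(S)$; 3. $Curv_\Gamma(X,Y)=\nu\bigl(d(\widehat\omega(\overline X,\overline Y))\bigr)$ for all $X,Y\in\chi(S)$, where $d(\widehat\omega(\overline X,\overline Y))$ is the differential of the function $\widehat\omega(\overline X,\overline Y)$ on $\mathcal N$; 4. $(d\widehat\omega)(\overline X_1,\overline X_2,\overline X_3)=0$ for all $X_1,X_2,X_3\in\chi(S)$. Here $[\cdot,\cdot]$ on multivector fields is the Schouten bracket. -/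

import Mathlib

open Bundle Manifold Topology VectorField
open scoped ContDiff

noncomputable section

namespace Coupling

/-! ### Tensor fields on a smooth manifold -/

section Tensors

variable {E : Type*} [NormedAddCommGroup E] [NormedSpace ℝ E] {H : Type*} [TopologicalSpace H]
  (I : ModelWithCorners ℝ E H) {M : Type*} [TopologicalSpace M] [ChartedSpace H M]

/-- Smooth vector fields, i.e. smooth sections of the tangent bundle. -/
def IsSmoothVectorField [IsManifold I ∞ M] (X : ∀ x : M, TangentSpace I x) : Prop :=
  ContMDiff I I.tangent ∞ (fun x => (⟨x, X x⟩ : TangentBundle I M))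

/-- Smooth 1-forms: fields of covectors whose pairing with every smooth vector field is smooth. -/
def IsSmoothOneForm [IsManifold I ∞ M] (α : ∀ x : M, Module.Dual ℝ (TangentSpace I x)) : Prop :=
  ∀ X : ∀ x : M, TangentSpace I x, IsSmoothVectorField I X →
    ContMDiff I 𝓘(ℝ, ℝ) ∞ (fun x => α x (X x))

/-- The differential `df` of a real function, as a field of covectors. -/
def differential (f : M → ℝ) (x : M) : Module.Dual ℝ (TangentSpace I x) :=
  (mvfderiv I f x).toLinearMap

/-- Smooth 2-forms. -/
structure IsTwoForm [IsManifold I ∞ M]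
    (Ω : ∀ x : M, LinearMap.BilinForm ℝ (TangentSpace I x)) : Prop where
  alt : ∀ x, (Ω x).IsAlt
  smooth : ∀ X Y : ∀ x : M, TangentSpace I x, IsSmoothVectorField I X → IsSmoothVectorField I Y →
    ContMDiff I 𝓘(ℝ, ℝ) ∞ (fun x => Ω x (X x) (Y x))

/-- The value `dΩ(X, Y, Z)` of the exterior derivative of a 2-form on three vector fields. -/
def extDerivTwoForm (Ω : ∀ x : M, LinearMap.BilinForm ℝ (TangentSpace I x))
    (X Y Z : ∀ x : M, TangentSpace I x) (x : M) : ℝ :=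
  differential I (fun y => Ω y (Y y) (Z y)) x (X x)
    + differential I (fun y => Ω y (Z y) (X y)) x (Y x)
    + differential I (fun y => Ω y (X y) (Y y)) x (Z x)
    - Ω x (mlieBracket I X Y x) (Z x)
    - Ω x (mlieBracket I Y Z x) (X x)
    - Ω x (mlieBracket I Z X x) (Y x)

/-- Symplectic forms: smooth, nondegenerate, closed 2-forms. -/
structure IsSymplectic [IsManifold I ∞ M]
    (Ω : ∀ x : M, LinearMap.BilinForm ℝ (TangentSpace I x)) : Prop extends IsTwoForm I Ω where
  nondegenerate : ∀ x, (Ω x).Nondegenerate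
  closed : ∀ X Y Z : ∀ x : M, TangentSpace I x, IsSmoothVectorField I X →
    IsSmoothVectorField I Y → IsSmoothVectorField I Z → ∀ x, extDerivTwoForm I Ω X Y Z x = 0

/-- Smooth bivector fields. A bivector `Λ ∈ Λ²TₓM` is given by its contraction
`T*ₓM → TₓM`, `α ↦ Λ α := Λ(α, ·)`, so that `Λ(α, β) = β (Λ α)`, and this expression is
alternating in `α`, `β`. -/
structure IsBivectorField [IsManifold I ∞ M]
    (Λ : ∀ x : M, Module.Dual ℝ (TangentSpace I x) →ₗ[ℝ] TangentSpace I x) : Prop where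
  alt : ∀ (x : M) (α : Module.Dual ℝ (TangentSpace I x)), α (Λ x α) = 0
  smooth : ∀ α β : ∀ x : M, Module.Dual ℝ (TangentSpace I x),
    IsSmoothOneForm I α → IsSmoothOneForm I β →
      ContMDiff I 𝓘(ℝ, ℝ) ∞ (fun x => β x (Λ x (α x)))

/-- The function `Λ(df, dg)`. -/
def pairing (Λ : ∀ x : M, Module.Dual ℝ (TangentSpace I x) →ₗ[ℝ] TangentSpace I x)
    (f g : M → ℝ) (x : M) : ℝ :=
  differential I g x (Λ x (differential I f x))

/-- The Schouten bracket `[A, B]` of two bivector fields, evaluated on `df, dg, dh`. These values,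
for all smooth functions `f`, `g`, `h`, determine the trivector field `[A, B]`. -/
def schouten (A B : ∀ x : M, Module.Dual ℝ (TangentSpace I x) →ₗ[ℝ] TangentSpace I x)
    (f g h : M → ℝ) (x : M) : ℝ :=
  pairing I A (pairing I B f g) h x + pairing I A (pairing I B g h) f x
    + pairing I A (pairing I B h f) g x
    + pairing I B (pairing I A f g) h x + pairing I B (pairing I A g h) f x
    + pairing I B (pairing I A h f) g x

/-- The Schouten bracket `[X, Λ]` (that is, the Lie derivative `L_X Λ`) of a vector field and a
bivector field, evaluated on `df, dg`. -/
def schoutenVector (X : ∀ x : M, TangentSpace I x)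
    (Λ : ∀ x : M, Module.Dual ℝ (TangentSpace I x) →ₗ[ℝ] TangentSpace I x)
    (f g : M → ℝ) (x : M) : ℝ :=
  differential I (pairing I Λ f g) x (X x)
    - pairing I Λ (fun y => differential I f y (X y)) g x
    - pairing I Λ f (fun y => differential I g y (X y)) x

/-- Poisson bivector fields: smooth bivector fields `Λ` with `[Λ, Λ] = 0`. -/
structure IsPoisson [IsManifold I ∞ M]
    (Λ : ∀ x : M, Module.Dual ℝ (TangentSpace I x) →ₗ[ℝ] TangentSpace I x) : Prop
    extends IsBivectorField I Λ where
  schouten_self : ∀ f g h : M → ℝ, ContMDiff I 𝓘(ℝ, ℝ) ∞ f → ContMDiff I 𝓘(ℝ, ℝ) ∞ g →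
    ContMDiff I 𝓘(ℝ, ℝ) ∞ h → ∀ x, schouten I Λ Λ f g h x = 0

end Tensors

/-! ### Connections and geometric data -/

section Connection

variable {EN : Type*} [NormedAddCommGroup EN] [NormedSpace ℝ EN]
  {HN : Type*} [TopologicalSpace HN] (IN : ModelWithCorners ℝ EN HN)
  {N : Type*} [TopologicalSpace N] [ChartedSpace HN N]
  {ES : Type*} [NormedAddCommGroup ES] [NormedSpace ℝ ES]
  {HS : Type*} [TopologicalSpace HS] (IS : ModelWithCorners ℝ ES HS)
  {S : Type*} [TopologicalSpace S] [ChartedSpace HS S]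

/-- The vertical space `Vert_x = ker (p_*)_x`. -/
def vert (p : N → S) (x : N) : Submodule ℝ (TangentSpace IN x) :=
  LinearMap.ker (mfderiv IN IS p x).toLinearMap

/-- An Ehresmann connection: a smooth projection `TN → Vert`. -/
structure EhresmannConnection [IsManifold IN ∞ N] (p : N → S) where
  /-- the projection -/
  toFun : ∀ x : N, TangentSpace IN x →ₗ[ℝ] TangentSpace IN x
  mem_vert : ∀ x v, toFun x v ∈ vert IN IS p x
  apply_of_mem : ∀ x, ∀ v ∈ vert IN IS p x, toFun x v = v
  smooth : ∀ Y : ∀ x : N, TangentSpace IN x, IsSmoothVectorField IN Y →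
    IsSmoothVectorField IN (fun x => toFun x (Y x))

variable {IN IS} {p : N → S} [IsManifold IN ∞ N]

namespace EhresmannConnection

variable (Γ : EhresmannConnection IN IS p)

/-- The horizontal space `Hor_x`, the kernel of the projection. -/
def hor (x : N) : Submodule ℝ (TangentSpace IN x) := LinearMap.ker (Γ.toFun x)

lemma bijective_restrict (hp : ∀ x, Function.Surjective (mfderiv IN IS p x)) (x : N) :
    Function.Bijective ((mfderiv IN IS p x).toLinearMap ∘ₗ (Γ.hor x).subtype) := by
  constructor
  · rw [← LinearMap.ker_eq_bot, LinearMap.ker_eq_bot']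
    rintro ⟨v, hv⟩ h
    have h1 : Γ.toFun x v = v := Γ.apply_of_mem x v h
    have h2 : Γ.toFun x v = 0 := hv
    exact Subtype.ext (h1.symm.trans h2)
  · intro w
    obtain ⟨v, rfl⟩ := hp x w
    refine ⟨⟨v - Γ.toFun x v, ?_⟩, ?_⟩
    · change Γ.toFun x (v - Γ.toFun x v) = 0
      rw [map_sub, Γ.apply_of_mem x _ (Γ.mem_vert x v), sub_self]
    · change mfderiv IN IS p x (v - Γ.toFun x v) = mfderiv IN IS p x v
      have h : mfderiv IN IS p x (Γ.toFun x v) = 0 := Γ.mem_vert x v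
      rw [map_sub, h, sub_zero]

/-- The isomorphism `p_* : Hor_x ≃ T_{p(x)}S`, where `p` is a submersion. -/
def horEquiv (hp : ∀ x, Function.Surjective (mfderiv IN IS p x)) (x : N) :
    Γ.hor x ≃ₗ[ℝ] TangentSpace IS (p x) :=
  LinearEquiv.ofBijective _ (Γ.bijective_restrict hp x)

instance finiteDimensional_hor [FiniteDimensional ℝ EN] (x : N) :
    FiniteDimensional ℝ (Γ.hor x) :=
  haveI : FiniteDimensional ℝ (TangentSpace IN x) := inferInstanceAs (FiniteDimensional ℝ EN)
  inferInstance

/-- The horizontal lift of a vector field on `S`: the horizontal vector field `X̄` with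
`p_* X̄ = X`. -/
def lift (hp : ∀ x, Function.Surjective (mfderiv IN IS p x)) (X : ∀ s : S, TangentSpace IS s)
    (x : N) : TangentSpace IN x :=
  (Γ.horEquiv hp x).symm (X (p x))

/-- The curvature `Curv(X, Y) = [X̄, Ȳ] - lift of [X, Y]`. -/
def curv (hp : ∀ x, Function.Surjective (mfderiv IN IS p x)) (X Y : ∀ s : S, TangentSpace IS s)
    (x : N) : TangentSpace IN x :=
  mlieBracket IN (Γ.lift hp X) (Γ.lift hp Y) x - Γ.lift hp (mlieBracket IS X Y) x

end EhresmannConnection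

variable (IN IS)

/-- Geometric data `(Γ, ν, φ)` for the projection `p : N → S` with zero section `σ : S → N`, where
`S` carries the 2-form `Ω`. The 2-form `φ ∈ Ω²(S) ⊗ C^∞(N)` is a field of alternating forms `φ x`
on `T_{p(x)}S`, `x ∈ N`, such that `φ(X, Y) ∈ C^∞(N)` for all vector fields `X`, `Y` on `S`. -/
structure GeometricData [IsManifold IS ∞ S] (p : N → S) (σ : S → N)
    (Ω : ∀ s : S, LinearMap.BilinForm ℝ (TangentSpace IS s)) where
  /-- the Ehresmann connection -/
  Γ : EhresmannConnection IN IS p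
  /-- the vertical bivector field -/
  ν : ∀ x : N, Module.Dual ℝ (TangentSpace IN x) →ₗ[ℝ] TangentSpace IN x
  isBivectorField_ν : IsBivectorField IN ν
  ν_mem_vert : ∀ x α, ν x α ∈ vert IN IS p x
  /-- the nondegenerate 2-form on `S` with values in the functions on `N` -/
  φ : ∀ x : N, LinearMap.BilinForm ℝ (TangentSpace IS (p x))
  φ_alt : ∀ x, (φ x).IsAlt
  φ_smooth : ∀ X Y : ∀ s : S, TangentSpace IS s, IsSmoothVectorField IS X →
    IsSmoothVectorField IS Y → ContMDiff IN 𝓘(ℝ, ℝ) ∞ (fun x => φ x (X (p x)) (Y (p x)))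
  φ_nondegenerate : ∀ x, (φ x).Nondegenerate
  φ_zeroSection : ∀ s, φ (σ s) = Ω (p (σ s))

variable {IN IS}

namespace GeometricData

variable [IsManifold IS ∞ S] {σ : S → N} {Ω : ∀ s : S, LinearMap.BilinForm ℝ (TangentSpace IS s)}
  (D : GeometricData IN IS p σ Ω)

/-- The coupling 2-form `ω̂ = p^*φ` on `N`. -/
def couplingForm (x : N) : LinearMap.BilinForm ℝ (TangentSpace IN x) :=
  (D.φ x).comp (mfderiv IN IS p x).toLinearMap (mfderiv IN IS p x).toLinearMap

/-- The restriction of the coupling form to `Hor_x`. -/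
def horForm (x : N) : LinearMap.BilinForm ℝ (D.Γ.hor x) :=
  (D.couplingForm x).restrict (D.Γ.hor x)

lemma horForm_nondegenerate (hp : ∀ x, Function.Surjective (mfderiv IN IS p x)) (x : N) :
    (D.horForm x).Nondegenerate := by
  have key : ∀ u v : D.Γ.hor x,
      D.horForm x u v = D.φ x (D.Γ.horEquiv hp x u) (D.Γ.horEquiv hp x v) := fun _ _ => rfl
  constructor
  · intro u hu
    apply (D.Γ.horEquiv hp x).map_eq_zero_iff.1
    refine (D.φ_nondegenerate x).1 _ fun w => ?_
    obtain ⟨v, rfl⟩ := (D.Γ.horEquiv hp x).surjective w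
    rw [← key, hu]
  · intro u hu
    apply (D.Γ.horEquiv hp x).map_eq_zero_iff.1
    refine (D.φ_nondegenerate x).2 _ fun w => ?_
    obtain ⟨v, rfl⟩ := (D.Γ.horEquiv hp x).surjective w
    rw [← key, hu]

/-- The horizontal coupling bivector `μ`, the inverse of the restriction of `ω̂` to `Hor`: for a
covector `α`, `μ α` is the element of `Hor_x` with `ω̂(μ α, ·) = α` on `Hor_x`. -/
def μ [FiniteDimensional ℝ EN] (hp : ∀ x, Function.Surjective (mfderiv IN IS p x)) (x : N) :
    Module.Dual ℝ (TangentSpace IN x) →ₗ[ℝ] TangentSpace IN x :=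
  (D.Γ.hor x).subtype ∘ₗ
    ((D.horForm x).toDual (D.horForm_nondegenerate hp x)).symm.toLinearMap ∘ₗ
      (D.Γ.hor x).subtype.dualMap

end GeometricData

end Connection

/-! ### Tubular neighborhoods -/

section Tubular

variable {EP : Type*} [NormedAddCommGroup EP] [NormedSpace ℝ EP]
  {HP : Type*} [TopologicalSpace HP] (IP : ModelWithCorners ℝ EP HP)
  {P : Type*} [TopologicalSpace P] [ChartedSpace HP P]
  {ES : Type*} [NormedAddCommGroup ES] [NormedSpace ℝ ES]
  {HS : Type*} [TopologicalSpace HS] (IS : ModelWithCorners ℝ ES HS)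
  {S : Type*} [TopologicalSpace S] [ChartedSpace HS S]
  (F : Type*) [NormedAddCommGroup F] [NormedSpace ℝ F]
  (V : S → Type*) [TopologicalSpace (TotalSpace F V)] [∀ s, AddCommGroup (V s)]
  [∀ s, Module ℝ (V s)] [∀ s, TopologicalSpace (V s)] [FiberBundle F V] [VectorBundle ℝ F V]
  [ContMDiffVectorBundle ∞ F V IS]

/-- A tubular neighborhood of the submanifold `ι : S → P`: an open subset `N` of `P` containing
`S`, with a diffeomorphism from `N` to an open neighborhood of the zero section of the vector
bundle `V` over `S` (possibly all of `V`), which maps `S` to the zero section by the identity. -/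
structure TubularNeighborhood (ι : S → P) where
  /-- the underlying open set -/
  N : TopologicalSpace.Opens P
  /-- the identification with a neighborhood of the zero section -/
  j : N → TotalSpace F V
  injective_j : Function.Injective j
  isLocalDiffeomorph_j : IsLocalDiffeomorph IP (IS.prod 𝓘(ℝ, F)) ∞ j
  ι_mem : ∀ s, ι s ∈ N
  j_ι : ∀ s, j ⟨ι s, ι_mem s⟩ = zeroSection F V s

variable {IP IS F V}

namespace TubularNeighborhood

variable {ι : S → P} (T : TubularNeighborhood IP IS F V ι)

/-- The projection `p : N → S`. -/
def proj (x : T.N) : S := (T.j x).proj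

/-- The zero section `S → N`. -/
def zero (s : S) : T.N := ⟨ι s, T.ι_mem s⟩

/-- The projection is a submersion. -/
lemma surjective_mfderiv_proj (x : T.N) : Function.Surjective (mfderiv IP IS T.proj x) := by
  have hπ : MDifferentiable (IS.prod 𝓘(ℝ, F)) IS (TotalSpace.proj : TotalSpace F V → S) :=
    (contMDiff_proj (n := ∞) V).mdifferentiable (by simp)
  have hj : MDifferentiableAt IP (IS.prod 𝓘(ℝ, F)) T.j x :=
    T.isLocalDiffeomorph_j.mdifferentiable (by simp) x
  have h1 : mfderiv IP IS T.proj x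
      = (mfderiv (IS.prod 𝓘(ℝ, F)) IS TotalSpace.proj (T.j x)).comp
          (mfderiv IP (IS.prod 𝓘(ℝ, F)) T.j x) := mfderiv_comp x (hπ _) hj
  have h0 : Function.Surjective (mfderiv IP (IS.prod 𝓘(ℝ, F)) T.j x) :=
    (T.isLocalDiffeomorph_j.mfderivToContinuousLinearEquiv (by simp) x).surjective
  suffices h : ∀ y : TotalSpace F V,
      Function.Surjective (mfderiv (IS.prod 𝓘(ℝ, F)) IS TotalSpace.proj y) by
    rw [h1]
    exact (h (T.j x)).comp h0
  intro y
  let e := trivializationAt F V y.proj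
  have hy : y ∈ e.source := e.mem_source.2 (FiberBundle.mem_baseSet_trivializationAt F V y.proj)
  -- the local section through `y` which is constant in a trivialization
  let g : S → TotalSpace F V := fun s => e.toOpenPartialHomeomorph.symm (s, (e y).2)
  have hgy : g y.proj = y := by
    have : (y.proj, (e y).2) = e y := Prod.ext (e.coe_fst hy).symm rfl
    change e.toOpenPartialHomeomorph.symm (y.proj, (e y).2) = y
    rw [this]
    exact e.toOpenPartialHomeomorph.left_inv hy
  have hmem : ∀ s ∈ e.baseSet, (s, (e y).2) ∈ e.target := fun s hs => e.mem_target.2 hs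
  have hbase : e.baseSet ∈ 𝓝 y.proj :=
    e.open_baseSet.mem_nhds (FiberBundle.mem_baseSet_trivializationAt F V y.proj)
  have hg : MDifferentiableAt IS (IS.prod 𝓘(ℝ, F)) g y.proj := by
    have h : ContMDiffOn IS (IS.prod 𝓘(ℝ, F)) ∞ g e.baseSet :=
      (e.contMDiffOn_symm (IB := IS) (n := ∞)).comp
        (contMDiffOn_id.prodMk contMDiffOn_const) hmem
    exact (h.contMDiffAt hbase).mdifferentiableAt (by simp)
  have hid : (TotalSpace.proj ∘ g) =ᶠ[𝓝 y.proj] id := by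
    filter_upwards [hbase] with s hs
    exact e.proj_symm_apply (hmem s hs)
  have h2 : (mfderiv (IS.prod 𝓘(ℝ, F)) IS TotalSpace.proj (g y.proj)).comp
      (mfderiv IS (IS.prod 𝓘(ℝ, F)) g y.proj) = ContinuousLinearMap.id ℝ ES := by
    rw [← mfderiv_comp y.proj (hπ _) hg, hid.mfderiv_eq, mfderiv_id]
    rfl
  have h3 : Function.Surjective (mfderiv (IS.prod 𝓘(ℝ, F)) IS TotalSpace.proj (g y.proj)) :=
    fun w => ⟨mfderiv IS (IS.prod 𝓘(ℝ, F)) g y.proj w, DFunLike.congr_fun h2 w⟩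
  rw [hgy] at h3
  exact h3

end TubularNeighborhood

end Tubular

end Coupling

end

/-!
The Jacobiator of `π = μ + ν` on functions `f, g, h` is the value of `½[π, π]` on `df, dg, dh`. At a
fixed point `x`, every function is the sum of a function `F ∘ p` from the base and a function whose
differential at `x` kills the horizontal space ("vertical at `x`"), so by trilinearity `[π, π] = 0`
at `x` can be tested on four types of triples, and each type is one of the four conditions.
Since `ν` is vertical, the Hamiltonian field of `F ∘ p` with respect to `π` is the horizontal field
`X_F = μ d(F ∘ p)`.

* Three functions from the base: the Jacobiator is `-dω̂(X_F, X_G, X_K)` (`extDeriv_basicField`,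
  `extDeriv_lift_iff`).
* Two functions from the base, one vertical `k`: the Jacobiator is
  `dk(ν d{F, G}) - dk(Γ[X_F, X_G])`. This is minus the value on `X_F, X_G` of an operation that is
  tensorial in horizontal fields, and whose value on lifts `X̄, Ȳ` is
  `dk(Curv(X, Y) - ν d(ω̂(X̄, Ȳ)))` (`curvatureDefect`, `curv_eq_iff`).
* One function from the base, two vertical `g, h`: the Jacobiator is `-(L_{X_F} ν)(dg, dh)`, which is
  tensorial in the horizontal field (`schoutenVector_lift_iff`).
* Three vertical functions: the Jacobiators of `π` and `ν` agree (`jacobiator_ν_iff`).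

In the last two items the contribution of `μ` vanishes because `μ(dg, dh)` vanishes to second order
at `x` if `g` and `h` are vertical there (`differential_pairing_μ_eq_zero`). In the first three, the
nondegeneracy of `φ` says that the values at `x` of the fields `X_F` and those of the lifts `X̄` both
exhaust the horizontal space, so tensoriality lets one replace the former by the latter.

Two general facts support this: the formula `[V, W] f = V(W f) - W(V f)`
(`derivAlong_mlieBracket`), and the smoothness of horizontal lifts and of `μ`, which follows by
solving linear systems with smooth coefficients in coordinate frames (`isSmoothVectorField_lift`,
`isSmoothVectorField_μ`).
-/

noncomputable section

namespace Coupling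

/-! ### Smooth functions and vector fields -/

section Foundations

variable {E : Type*} [NormedAddCommGroup E] [NormedSpace ℝ E] {H : Type*} [TopologicalSpace H]
  (I : ModelWithCorners ℝ E H) {M : Type*} [TopologicalSpace M] [ChartedSpace H M]

/-- Smooth real functions. -/
abbrev IsSmoothFunction (f : M → ℝ) : Prop := ContMDiff I 𝓘(ℝ, ℝ) ∞ f

/-- The derivative `X f` of a function along a vector field. -/
def derivAlong (X : ∀ x : M, TangentSpace I x) (f : M → ℝ) (x : M) : ℝ :=
  differential I f x (X x)

variable {I}

lemma IsSmoothFunction.mdiffAt {f : M → ℝ} (hf : IsSmoothFunction I f) (x : M) :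
    MDifferentiableAt I 𝓘(ℝ, ℝ) f x :=
  hf.mdifferentiable (by simp) x

section Differential

variable {f g : M → ℝ}

lemma differential_add (hf : IsSmoothFunction I f) (hg : IsSmoothFunction I g) (x : M) :
    differential I (f + g) x = differential I f x + differential I g x := by
  simp only [differential]
  rw [mvfderiv_add (hf.mdiffAt x) (hg.mdiffAt x)]
  rfl

lemma differential_sub (hf : IsSmoothFunction I f) (hg : IsSmoothFunction I g) (x : M) :
    differential I (f - g) x = differential I f x - differential I g x := by
  simp only [differential]
  rw [mvfderiv_sub (hf.mdiffAt x) (hg.mdiffAt x)]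
  rfl

lemma differential_neg (f : M → ℝ) (x : M) : differential I (-f) x = -differential I f x := by
  simp only [differential]
  rw [mvfderiv_neg]
  rfl

lemma differential_mul (hf : IsSmoothFunction I f) (hg : IsSmoothFunction I g) (x : M) :
    differential I (f * g) x = f x • differential I g x + g x • differential I f x := by
  simp only [differential]
  rw [mvfderiv_mul (hf.mdiffAt x) (hg.mdiffAt x)]
  rfl

lemma differential_const (c : ℝ) (x : M) : differential I (fun _ : M => c) x = 0 := by
  simp only [differential]
  rw [mvfderiv_const]
  rfl

lemma differential_congr {x : M} (h : f =ᶠ[𝓝 x] g) :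
    differential I f x = differential I g x := by
  unfold differential
  have h1 := h.mfderiv_eq (I := I) (I' := 𝓘(ℝ, ℝ))
  ext v
  exact DFunLike.congr_fun h1 v

variable [IsManifold I ∞ M]

lemma IsSmoothFunction.derivAlong (hf : IsSmoothFunction I f) {X : ∀ x : M, TangentSpace I x}
    (hX : IsSmoothVectorField I X) : IsSmoothFunction I (derivAlong I X f) := by
  have h1 : ContMDiff I.tangent 𝓘(ℝ, ℝ).tangent ∞ (tangentMap I 𝓘(ℝ, ℝ) f) :=
    ContMDiff.contMDiff_tangentMap (n := ∞) hf (by simp)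
  have h2 := h1.comp hX
  intro x
  have h3 := ((contMDiffAt_totalSpace (IB := 𝓘(ℝ, ℝ)) (F := ℝ)
    (E := fun x : ℝ => TangentSpace 𝓘(ℝ, ℝ) x)).1 (h2 x)).2
  simpa using! h3

lemma isSmoothOneForm_differential (hf : IsSmoothFunction I f) :
    IsSmoothOneForm I (differential I f) :=
  fun _ hX => hf.derivAlong hX

end Differential

section VectorField

variable [IsManifold I ∞ M] {X Y : ∀ x : M, TangentSpace I x} {f : M → ℝ}

lemma IsSmoothVectorField.mdiffAt (hX : IsSmoothVectorField I X) (x : M) :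
    MDifferentiableAt I I.tangent (fun x => (⟨x, X x⟩ : TangentBundle I M)) x :=
  ContMDiff.mdifferentiable hX (by simp) x

lemma IsSmoothVectorField.add (hX : IsSmoothVectorField I X) (hY : IsSmoothVectorField I Y) :
    IsSmoothVectorField I (X + Y) := ContMDiff.add_section hX hY

lemma IsSmoothVectorField.sub (hX : IsSmoothVectorField I X) (hY : IsSmoothVectorField I Y) :
    IsSmoothVectorField I (X - Y) := ContMDiff.sub_section hX hY

lemma IsSmoothVectorField.smul (hf : IsSmoothFunction I f) (hX : IsSmoothVectorField I X) :
    IsSmoothVectorField I (f • X) := ContMDiff.smul_section hf hX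

lemma IsSmoothVectorField.mlieBracket [CompleteSpace E] (hX : IsSmoothVectorField I X)
    (hY : IsSmoothVectorField I Y) : IsSmoothVectorField I (mlieBracket I X Y) :=
  haveI : IsManifold I (((⊤ : ℕ∞) : WithTop ℕ∞) + 1) M := by simpa using ‹IsManifold I ∞ M›
  haveI : IsManifold I (minSmoothness ℝ 2) M :=
    IsManifold.of_le (n := ∞) (by simpa using (ENat.LEInfty.out : (2 : ℕ∞ω) ≤ ∞))
  haveI : IsManifold I (minSmoothness ℝ 3) M :=
    IsManifold.of_le (n := ∞) (by simpa using (ENat.LEInfty.out : (3 : ℕ∞ω) ≤ ∞))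
  ContDiff.mlieBracket_vectorField (m := ⊤) (n := ⊤) hX hY (by simp)

end VectorField

section DerivAlong

variable {f g : M → ℝ}

lemma derivAlong_add_fun (X : ∀ x : M, TangentSpace I x) (hf : IsSmoothFunction I f)
    (hg : IsSmoothFunction I g) :
    derivAlong I X (f + g) = derivAlong I X f + derivAlong I X g := by
  ext x
  simp [derivAlong, differential_add hf hg]

lemma derivAlong_neg_fun (X : ∀ x : M, TangentSpace I x) (f : M → ℝ) :
    derivAlong I X (-f) = -derivAlong I X f := by
  ext x
  simp [derivAlong, differential_neg]

lemma derivAlong_mul_fun (X : ∀ x : M, TangentSpace I x) (hf : IsSmoothFunction I f)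
    (hg : IsSmoothFunction I g) :
    derivAlong I X (f * g) = f * derivAlong I X g + g * derivAlong I X f := by
  ext x
  simp [derivAlong, differential_mul hf hg]

lemma derivAlong_add (X Y : ∀ x : M, TangentSpace I x) (f : M → ℝ) :
    derivAlong I (X + Y) f = derivAlong I X f + derivAlong I Y f := by
  ext x
  simp [derivAlong]

lemma derivAlong_smul (g : M → ℝ) (X : ∀ x : M, TangentSpace I x) (f : M → ℝ) :
    derivAlong I (g • X) f = g * derivAlong I X f := by
  ext x
  simp [derivAlong]

lemma derivAlong_zero_fun (X : ∀ x : M, TangentSpace I x) :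
    derivAlong I X (0 : M → ℝ) = 0 := by
  ext x
  exact congrArg (· (X x)) (differential_const (I := I) 0 x)

end DerivAlong

/-! ### Cut-off coordinates and tensoriality -/

section LocalCoords

variable [IsManifold I ∞ M]

variable (I) in
/-- Coordinates around a point, cut off to global objects: functions `coord i` and vector fields
`frame i` on all of `M` which on the open set `{χ ≠ 0}` are the coordinates and coordinate fields of
a chart. The cutoff `χ` equals `1` at the point. -/
structure LocalCoords (x₀ : M) where
  /-- the cutoff function -/
  χ : M → ℝ
  smooth_χ : IsSmoothFunction I χ
  χ_self : χ x₀ = 1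
  /-- the coordinate functions -/
  coord : Fin (Module.finrank ℝ E) → M → ℝ
  smooth_coord : ∀ i, IsSmoothFunction I (coord i)
  /-- the coordinate vector fields -/
  frame : Fin (Module.finrank ℝ E) → ∀ x : M, TangentSpace I x
  smooth_frame : ∀ i, IsSmoothVectorField I (frame i)
  dual : ∀ y, χ y ≠ 0 → ∀ i j, differential I (coord i) y (frame j y) = if i = j then 1 else 0
  expand : ∀ y, χ y ≠ 0 → ∀ v : TangentSpace I y,
    v = ∑ i, differential I (coord i) y v • frame i y

lemma LocalCoords.eventually {x₀ : M} (c : LocalCoords I x₀) : ∀ᶠ y in 𝓝 x₀, c.χ y ≠ 0 :=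
  c.smooth_χ.continuous.continuousAt.eventually_ne (by simp [c.χ_self])

lemma LocalCoords.χ_self_ne {x₀ : M} (c : LocalCoords I x₀) : c.χ x₀ ≠ 0 := by
  simp [c.χ_self]

variable [FiniteDimensional ℝ E] [T2Space M]

theorem nonempty_localCoords (x₀ : M) : Nonempty (LocalCoords I x₀) := by
  classical
  let b := Module.finBasis ℝ E
  let e := trivializationAt E (TangentSpace I : M → Type _) x₀
  have hbase : e.baseSet = (chartAt H x₀).source := TangentBundle.trivializationAt_baseSet x₀
  obtain ⟨ψ⟩ : Nonempty (SmoothBumpFunction I x₀) := inferInstance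
  have hone : ∀ᶠ y in 𝓝 x₀, ψ =ᶠ[𝓝 y] 1 := ψ.eventuallyEq_one.eventuallyEq_nhds
  have hU : {y | ψ =ᶠ[𝓝 y] 1} ∩ (chartAt H x₀).source ∈ 𝓝 x₀ :=
    Filter.inter_mem hone ((chartAt H x₀).open_source.mem_nhds (mem_chart_source H x₀))
  obtain ⟨χ, -, hχ⟩ := (SmoothBumpFunction.nhds_basis_tsupport (I := I) x₀).mem_iff.1 hU
  have hχ' : ∀ y, χ y ≠ 0 → ψ =ᶠ[𝓝 y] 1 ∧ y ∈ (chartAt H x₀).source := fun y hy =>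
    hχ (subset_tsupport _ hy)
  let q : Fin (Module.finrank ℝ E) → E →L[ℝ] ℝ := fun i => (b.coord i).toContinuousLinearMap
  let co : Fin (Module.finrank ℝ E) → M → ℝ := fun i y => ψ y • q i (extChartAt I x₀ y)
  let fr : Fin (Module.finrank ℝ E) → ∀ y : M, TangentSpace I y :=
    fun i => (ψ : M → ℝ) • e.localFrame b i
  have hq : ∀ y ∈ (chartAt H x₀).source,
      MDifferentiableAt I 𝓘(ℝ, E) (extChartAt I x₀) y := fun y hy =>
    mdifferentiableAt_extChartAt hy
  have hd : ∀ y, χ y ≠ 0 → ∀ i (v : TangentSpace I y),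
      differential I (co i) y v = b.repr (mfderiv I 𝓘(ℝ, E) (extChartAt I x₀) y v) i := by
    intro y hy i v
    obtain ⟨h1, h2⟩ := hχ' y hy
    have h3 : co i =ᶠ[𝓝 y] (q i ∘ extChartAt I x₀) := by
      filter_upwards [h1] with z hz
      simp [co, hz]
    rw [differential_congr h3]
    have h4 : mfderiv I 𝓘(ℝ, ℝ) (q i ∘ extChartAt I x₀) y =
        (mfderiv 𝓘(ℝ, E) 𝓘(ℝ, ℝ) (q i) (extChartAt I x₀ y)).comp
          (mfderiv I 𝓘(ℝ, E) (extChartAt I x₀) y) :=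
      mfderiv_comp y (q i).mdifferentiableAt (hq y h2)
    have h5 : mfderiv 𝓘(ℝ, E) 𝓘(ℝ, ℝ) (q i) (extChartAt I x₀ y) = q i := by
      rw [mfderiv_eq_fderiv]
      exact (q i).fderiv
    rw [h5] at h4
    exact DFunLike.congr_fun h4 v
  have hfr : ∀ y, χ y ≠ 0 → ∀ i, mfderiv I 𝓘(ℝ, E) (extChartAt I x₀) y (fr i y) = b i := by
    intro y hy i
    obtain ⟨h1, h2⟩ := hχ' y hy
    have hyb : y ∈ e.baseSet := hbase ▸ h2
    have h3 : fr i y = e.symmL ℝ y (b i) := by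
      have : ψ y = 1 := h1.self_of_nhds
      simp [fr, this, hyb, Bundle.Trivialization.basisAt]
    rw [h3, ← TangentBundle.continuousLinearMapAt_trivializationAt h2]
    exact e.continuousLinearMapAt_symmL hyb _
  refine ⟨⟨χ, χ.contMDiff, χ.eq_one, co, fun i => ?_, fr, fun i => ?_, ?_, ?_⟩⟩
  · exact ψ.contMDiff_smul ((q i).contMDiff.comp_contMDiffOn
      (contMDiffOn_extChartAt (I := I) (n := ∞)))
  · exact ContMDiffOn.smul_section_of_tsupport (u := (chartAt H x₀).source)
      ψ.contMDiff.contMDiffOn (chartAt H x₀).open_source ψ.tsupport_subset_chartAt_source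
      (hbase ▸ e.contMDiffOn_localFrame_baseSet ∞ b i)
  · intro y hy i j
    rw [hd y hy, hfr y hy, b.repr_self, Finsupp.single_apply]
    simp [eq_comm]
  · intro y hy v
    obtain ⟨h1, h2⟩ := hχ' y hy
    have hyb : y ∈ e.baseSet := hbase ▸ h2
    have hinj : Function.Injective (mfderiv I 𝓘(ℝ, E) (extChartAt I x₀) y) := by
      rw [← TangentBundle.continuousLinearMapAt_trivializationAt h2]
      exact Function.LeftInverse.injective (g := e.symmL ℝ y)
        fun v => e.symmL_continuousLinearMapAt hyb v
    apply hinj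
    rw [map_sum]
    conv_lhs => rw [← b.sum_repr (mfderiv I 𝓘(ℝ, E) (extChartAt I x₀) y v)]
    refine Finset.sum_congr rfl fun i _ => ?_
    rw [map_smul, hfr y hy, hd y hy]
    rfl


lemma exists_vectorField_eq (x : M) (v : TangentSpace I x) :
    ∃ X : ∀ x : M, TangentSpace I x, IsSmoothVectorField I X ∧ X x = v := by
  obtain ⟨c⟩ := nonempty_localCoords (I := I) x
  refine ⟨fun y => ∑ i, differential I (c.coord i) x v • c.frame i y, ?_, ?_⟩
  · exact ContMDiff.sum_section fun i _ => ContMDiff.const_smul_section (c.smooth_frame i)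
  · exact (c.expand x c.χ_self_ne v).symm

lemma eq_of_forall_differential {x : M} {u v : TangentSpace I x}
    (h : ∀ k : M → ℝ, IsSmoothFunction I k → differential I k x u = differential I k x v) :
    u = v := by
  obtain ⟨c⟩ := nonempty_localCoords (I := I) x
  rw [c.expand x c.χ_self_ne u, c.expand x c.χ_self_ne v]
  simp only [h _ (c.smooth_coord _)]

lemma exists_function_differential_eq (x : M) (β : Module.Dual ℝ (TangentSpace I x)) :
    ∃ f : M → ℝ, IsSmoothFunction I f ∧ differential I f x = β := by
  obtain ⟨c⟩ := nonempty_localCoords (I := I) x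
  have key : ∀ s : Finset (Fin (Module.finrank ℝ E)), ∃ f : M → ℝ, IsSmoothFunction I f ∧
      differential I f x = ∑ i ∈ s, β (c.frame i x) • differential I (c.coord i) x := by
    classical
    intro s
    induction s using Finset.induction_on with
    | empty => exact ⟨fun _ => 0, contMDiff_const, by rw [differential_const]; simp⟩
    | insert a s ha ih =>
      obtain ⟨f, hf, hfx⟩ := ih
      have hc : IsSmoothFunction I (fun _ : M => β (c.frame a x)) := contMDiff_const
      refine ⟨(fun _ => β (c.frame a x)) * c.coord a + f, (hc.mul (c.smooth_coord a)).add hf, ?_⟩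
      rw [differential_add (hc.mul (c.smooth_coord a)) hf, differential_mul hc (c.smooth_coord a),
        differential_const, hfx, Finset.sum_insert ha]
      simp
  obtain ⟨f, hf, hfx⟩ := key Finset.univ
  refine ⟨f, hf, ?_⟩
  rw [hfx]
  ext v
  conv_rhs => rw [c.expand x c.χ_self_ne v]
  simp [mul_comm]

/-- A vector field is smooth if it maps smooth functions to smooth functions. -/
lemma isSmoothVectorField_of_forall {Y : ∀ x : M, TangentSpace I x}
    (h : ∀ k : M → ℝ, IsSmoothFunction I k → IsSmoothFunction I (derivAlong I Y k)) :
    IsSmoothVectorField I Y := by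
  intro x
  obtain ⟨c⟩ := nonempty_localCoords (I := I) x
  have h1 : IsSmoothVectorField I
      (fun y => ∑ i, derivAlong I Y (c.coord i) y • c.frame i y) :=
    ContMDiff.sum_section fun i _ =>
      IsSmoothVectorField.smul (h _ (c.smooth_coord i)) (c.smooth_frame i)
  refine (h1 x).congr_of_eventuallyEq ?_
  filter_upwards [c.eventually] with y hy
  exact congrArg (TotalSpace.mk' E y) (c.expand y hy (Y y))

/-- A linear operation on smooth vector fields that is linear over smooth functions at `x` depends
only on the value of the field at `x`: if the field vanishes at `x`, cut it off near `x` and expand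
it in a coordinate frame. -/
lemma tensorial_eq_zero {x : M} {Φ : (∀ y : M, TangentSpace I y) → ℝ}
    (hadd : ∀ A B, IsSmoothVectorField I A → IsSmoothVectorField I B → Φ (A + B) = Φ A + Φ B)
    (hsmul : ∀ f A, IsSmoothFunction I f → IsSmoothVectorField I A → Φ (f • A) = f x * Φ A)
    {A : ∀ y : M, TangentSpace I y} (hA : IsSmoothVectorField I A) (h : A x = 0) : Φ A = 0 := by
  classical
  obtain ⟨c⟩ := nonempty_localCoords (I := I) x
  have h0 : Φ 0 = 0 := by
    have := hsmul (fun _ => 0) A contMDiff_const hA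
    rw [show (fun _ : M => (0 : ℝ)) • A = 0 from by ext y; simp] at this
    simpa using this
  let a : Fin (Module.finrank ℝ E) → M → ℝ := fun i => c.χ * derivAlong I A (c.coord i)
  have ha : ∀ i, IsSmoothFunction I (a i) := fun i =>
    c.smooth_χ.mul ((c.smooth_coord i).derivAlong hA)
  have hsum : ∀ s : Finset (Fin (Module.finrank ℝ E)),
      IsSmoothVectorField I (∑ i ∈ s, a i • c.frame i) ∧
        Φ (∑ i ∈ s, a i • c.frame i) = ∑ i ∈ s, a i x * Φ (c.frame i) := by
    intro s
    induction s using Finset.induction_on with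
    | empty => exact ⟨by
        have := IsSmoothVectorField.smul (f := fun _ => 0) (contMDiff_const (I := I)) hA
        rwa [show (fun _ : M => (0 : ℝ)) • A = 0 from by ext y; simp] at this, by simpa using h0⟩
    | insert i s hi ih =>
      have h1 := (c.smooth_frame i).smul (ha i)
      simp only [Finset.sum_insert hi]
      exact ⟨h1.add ih.1, by rw [hadd _ _ h1 ih.1, hsmul _ _ (ha i) (c.smooth_frame i), ih.2]⟩
  have hχA : c.χ • A = ∑ i, a i • c.frame i := by
    ext1 y
    rw [Finset.sum_apply]
    change c.χ y • A y = ∑ i, a i y • c.frame i y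
    by_cases hy : c.χ y = 0
    · simp [a, hy]
    · conv_lhs => rw [c.expand y hy (A y), Finset.smul_sum]
      simp [a, derivAlong, mul_smul]
  have h2 := hsmul c.χ A c.smooth_χ hA
  rw [c.χ_self, one_mul] at h2
  rw [← h2, hχA, (hsum _).2]
  refine Finset.sum_eq_zero fun i _ => ?_
  simp [a, derivAlong, h]

lemma tensorial_congr {x : M} {Φ : (∀ y : M, TangentSpace I y) → ℝ}
    (hadd : ∀ A B, IsSmoothVectorField I A → IsSmoothVectorField I B → Φ (A + B) = Φ A + Φ B)
    (hsmul : ∀ f A, IsSmoothFunction I f → IsSmoothVectorField I A → Φ (f • A) = f x * Φ A)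
    {A B : ∀ y : M, TangentSpace I y} (hA : IsSmoothVectorField I A)
    (hB : IsSmoothVectorField I B) (h : A x = B x) : Φ A = Φ B := by
  have h1 := hadd (A - B) B (hA.sub hB) hB
  rw [sub_add_cancel, tensorial_eq_zero hadd hsmul (hA.sub hB) (by simp [h]), zero_add] at h1
  exact h1

end LocalCoords

/-! ### The action of the Lie bracket on functions -/

section Bracket

variable [IsManifold I ∞ M] [FiniteDimensional ℝ E] [T2Space M]

/-- The Lie bracket acts on functions as the commutator. Compare the coefficients of `U` in the two
sides of the Leibniz identity for `V`, `W` and `f • U`, where `U` is a field that does not vanish at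
the point. -/
theorem derivAlong_mlieBracket {V W : ∀ x : M, TangentSpace I x} (hV : IsSmoothVectorField I V)
    (hW : IsSmoothVectorField I W) {f : M → ℝ} (hf : IsSmoothFunction I f) (x : M) :
    derivAlong I (mlieBracket I V W) f x
      = derivAlong I V (derivAlong I W f) x - derivAlong I W (derivAlong I V f) x := by
  have : CompleteSpace E := FiniteDimensional.complete ℝ E
  have : IsManifold I (minSmoothness ℝ 2) M :=
    IsManifold.of_le (n := ∞) (by simpa using (ENat.LEInfty.out : (2 : ℕ∞ω) ≤ ∞))
  have : IsManifold I (minSmoothness ℝ 3) M :=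
    IsManifold.of_le (n := ∞) (by simpa using (ENat.LEInfty.out : (3 : ℕ∞ω) ≤ ∞))
  rcases subsingleton_or_nontrivial E with hE | hE
  · have : Subsingleton (TangentSpace I x) := hE
    have h0 : ∀ (X : ∀ x : M, TangentSpace I x) (g : M → ℝ), derivAlong I X g x = 0 := by
      intro X g
      simp [derivAlong, Subsingleton.elim (X x) 0]
    simp [h0]
  have : Nontrivial (TangentSpace I x) := hE
  obtain ⟨u, hu⟩ := exists_ne (0 : TangentSpace I x)
  obtain ⟨U, hU, hUx⟩ := exists_vectorField_eq (I := I) x u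
  have hle : minSmoothness ℝ 2 ≤ ∞ := by simpa using (ENat.LEInfty.out : (2 : ℕ∞ω) ≤ ∞)
  have L : ∀ {T : ∀ x : M, TangentSpace I x}, IsSmoothVectorField I T →
      mlieBracket I V (mlieBracket I W T) x =
        mlieBracket I (mlieBracket I V W) T x + mlieBracket I W (mlieBracket I V T) x :=
    fun hT => leibniz_identity_mlieBracket_apply ((hV x).of_le hle) ((hW x).of_le hle)
      ((hT x).of_le hle)
  have R : ∀ {A T : ∀ x : M, TangentSpace I x} {g : M → ℝ}, IsSmoothFunction I g →
      IsSmoothVectorField I T →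
      mlieBracket I A (g • T) = derivAlong I A g • T + g • mlieBracket I A T := by
    intro A T g hg hT
    ext1 y
    exact mlieBracket_smul_right (hg.mdiffAt y) (hT.mdiffAt y)
  have S : ∀ {A T T' : ∀ x : M, TangentSpace I x}, IsSmoothVectorField I T →
      IsSmoothVectorField I T' →
      mlieBracket I A (T + T') x = mlieBracket I A T x + mlieBracket I A T' x :=
    fun hT hT' => mlieBracket_add_right (hT.mdiffAt x) (hT'.mdiffAt x)
  have h1 := L (hU.smul hf)
  have hVf := hf.derivAlong hV
  have hWf := hf.derivAlong hW
  rw [R hf hU, R hf hU, R hf hU, S (hU.smul hWf) ((hW.mlieBracket hU).smul hf),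
    S (hU.smul hVf) ((hV.mlieBracket hU).smul hf), R hWf hU, R hVf hU,
    R hf (hW.mlieBracket hU), R hf (hV.mlieBracket hU)] at h1
  simp only [Pi.add_apply, Pi.smul_apply'] at h1
  rw [L hU, hUx] at h1
  have h2 : (derivAlong I (mlieBracket I V W) f x - (derivAlong I V (derivAlong I W f) x
      - derivAlong I W (derivAlong I V f) x)) • u = 0 := by
    rw [smul_add] at h1
    rw [sub_smul, sub_smul, sub_eq_zero]
    generalize derivAlong I (mlieBracket I V W) f x • u = a at *
    generalize derivAlong I V (derivAlong I W f) x • u = b at *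
    generalize derivAlong I W (derivAlong I V f) x • u = c at *
    rw [← sub_eq_zero] at h1 ⊢
    refine neg_eq_zero.1 (Eq.trans ?_ h1)
    abel
  rcases smul_eq_zero.1 h2 with h3 | h3
  · linarith
  · exact absurd h3 hu

end Bracket

end Foundations

/-! ### Linear systems with smooth coefficients -/

section MatrixInverse

variable {E : Type*} [NormedAddCommGroup E] [NormedSpace ℝ E] {H : Type*} [TopologicalSpace H]
  {I : ModelWithCorners ℝ E H} {M : Type*} [TopologicalSpace M] [ChartedSpace H M]
  {n : Type*} [Fintype n] [DecidableEq n]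

lemma isSmoothFunction_det {B : M → Matrix n n ℝ}
    (hB : ∀ i j, IsSmoothFunction I (fun x => B x i j)) :
    IsSmoothFunction I (fun x => (B x).det) := by
  simp only [Matrix.det_apply]
  refine contMDiff_finsetSum fun σ _ => ?_
  simp only [Units.smul_def, zsmul_eq_mul]
  exact contMDiff_const.mul (contMDiff_finsetProd fun i _ => hB _ _)

lemma isSmoothFunction_adjugate {B : M → Matrix n n ℝ}
    (hB : ∀ i j, IsSmoothFunction I (fun x => B x i j)) (i j : n) :
    IsSmoothFunction I (fun x => (B x).adjugate i j) := by
  simp only [Matrix.adjugate_apply]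
  refine isSmoothFunction_det fun k l => ?_
  by_cases h : k = j
  · subst h
    simp only [Matrix.updateRow_self]
    exact contMDiff_const
  · simp only [Matrix.updateRow_ne h]
    exact hB k l

variable [IsManifold I ∞ M]

/-- A vector field whose coefficients with respect to smooth fields `w j` solve a linear system with
smooth entries, invertible at `x₀`, is smooth at `x₀`. -/
lemma contMDiffAt_of_linear_system {B : M → Matrix n n ℝ}
    (hB : ∀ i j, IsSmoothFunction I (fun x => B x i j)) {b : n → M → ℝ}
    (hb : ∀ i, IsSmoothFunction I (b i)) {w : n → ∀ x : M, TangentSpace I x}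
    (hw : ∀ i, IsSmoothVectorField I (w i)) {W : ∀ x : M, TangentSpace I x} {x₀ : M}
    (hdet : (B x₀).det ≠ 0)
    (h : ∀ᶠ x in 𝓝 x₀, (B x).det ≠ 0 →
      W x = ∑ j, ((B x)⁻¹.mulVec fun i => b i x) j • w j x) :
    ContMDiffAt I I.tangent ∞ (fun x => (⟨x, W x⟩ : TangentBundle I M)) x₀ := by
  have hd := isSmoothFunction_det hB
  let a : n → M → ℝ := fun j x => ((B x).adjugate.mulVec fun i => b i x) j
  have ha : ∀ j, IsSmoothFunction I (a j) := fun j =>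
    contMDiff_finsetSum fun i _ => (isSmoothFunction_adjugate hB j i).mul (hb i)
  have hZ : IsSmoothVectorField I (fun x => ∑ j, a j x • w j x) :=
    ContMDiff.sum_section fun j _ => IsSmoothVectorField.smul (ha j) (hw j)
  have hinv : ContMDiffAt I 𝓘(ℝ, ℝ) ∞ (fun x => ((B x).det)⁻¹) x₀ := (hd x₀).inv₀ hdet
  refine (ContMDiffAt.smul_section hinv (hZ x₀)).congr_of_eventuallyEq ?_
  filter_upwards [h, hd.continuous.continuousAt.eventually_ne hdet] with x hx hx'
  refine congrArg (TotalSpace.mk' E x) ?_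
  rw [hx hx', Pi.smul_apply', Finset.smul_sum]
  refine Finset.sum_congr rfl fun j _ => ?_
  simp [a, Matrix.inv_def, Matrix.smul_mulVec, mul_smul]

end MatrixInverse

/-! ### Smoothness of horizontal lifts and of the horizontal bivector -/

section Submersion

variable {EN : Type*} [NormedAddCommGroup EN] [NormedSpace ℝ EN]
  {HN : Type*} [TopologicalSpace HN] {IN : ModelWithCorners ℝ EN HN}
  {N : Type*} [TopologicalSpace N] [ChartedSpace HN N]
  {ES : Type*} [NormedAddCommGroup ES] [NormedSpace ℝ ES]
  {HS : Type*} [TopologicalSpace HS] {IS : ModelWithCorners ℝ ES HS}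
  {S : Type*} [TopologicalSpace S] [ChartedSpace HS S] {p : N → S}

lemma differential_comp (hps : ContMDiff IN IS ∞ p) {F : S → ℝ} (hF : IsSmoothFunction IS F)
    (x : N) (v : TangentSpace IN x) :
    differential IN (F ∘ p) x v = differential IS F (p x) (mfderiv IN IS p x v) :=
  mvfderiv_comp_apply x (hF.mdiffAt (p x)) (hps.mdifferentiable (by simp) x) v

variable [IsManifold IN ∞ N]

namespace EhresmannConnection

variable (Γ : EhresmannConnection IN IS p) (hp : ∀ x, Function.Surjective (mfderiv IN IS p x))

/-- The horizontal part of a vector field. -/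
def horPart (A : ∀ x : N, TangentSpace IN x) (x : N) : TangentSpace IN x := A x - Γ.toFun x (A x)

lemma mfderiv_toFun (x : N) (v : TangentSpace IN x) : mfderiv IN IS p x (Γ.toFun x v) = 0 :=
  Γ.mem_vert x v

lemma toFun_toFun (x : N) (v : TangentSpace IN x) : Γ.toFun x (Γ.toFun x v) = Γ.toFun x v :=
  Γ.apply_of_mem x _ (Γ.mem_vert x v)

lemma sub_toFun_mem_hor (x : N) (v : TangentSpace IN x) : v - Γ.toFun x v ∈ Γ.hor x := by
  change Γ.toFun x (v - Γ.toFun x v) = 0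
  rw [map_sub, Γ.toFun_toFun, sub_self]

lemma toFun_eq_zero {x : N} {v : TangentSpace IN x} (hv : v ∈ Γ.hor x) : Γ.toFun x v = 0 := hv

lemma horPart_mem_hor (A : ∀ x : N, TangentSpace IN x) (x : N) : Γ.horPart A x ∈ Γ.hor x :=
  Γ.sub_toFun_mem_hor x (A x)

lemma horPart_apply_of_mem {A : ∀ x : N, TangentSpace IN x} {x : N} (h : A x ∈ Γ.hor x) :
    Γ.horPart A x = A x := by
  rw [horPart, Γ.toFun_eq_zero h, sub_zero]

lemma horPart_eq_self {A : ∀ x : N, TangentSpace IN x} (h : ∀ x, A x ∈ Γ.hor x) :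
    Γ.horPart A = A :=
  funext fun x => Γ.horPart_apply_of_mem (h x)

lemma horPart_add (A B : ∀ x : N, TangentSpace IN x) :
    Γ.horPart (A + B) = Γ.horPart A + Γ.horPart B := by
  ext1 x
  simp only [horPart, Pi.add_apply, map_add]
  abel

lemma horPart_smul (f : N → ℝ) (A : ∀ x : N, TangentSpace IN x) :
    Γ.horPart (f • A) = f • Γ.horPart A := by
  ext1 x
  simp only [horPart, Pi.smul_apply', map_smul, smul_sub]

variable {Γ} in
lemma _root_.Coupling.IsSmoothVectorField.horPart {A : ∀ x : N, TangentSpace IN x}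
    (hA : IsSmoothVectorField IN A) : IsSmoothVectorField IN (Γ.horPart A) :=
  hA.sub (Γ.smooth A hA)

lemma mfderiv_sub_toFun (x : N) (v : TangentSpace IN x) :
    mfderiv IN IS p x (v - Γ.toFun x v) = mfderiv IN IS p x v := by
  rw [map_sub, Γ.mfderiv_toFun, sub_zero]

lemma eq_of_mem_hor {x : N} {u v : TangentSpace IN x} (hu : u ∈ Γ.hor x) (hv : v ∈ Γ.hor x)
    (h : mfderiv IN IS p x u = mfderiv IN IS p x v) : u = v := by
  have h1 : Γ.toFun x (u - v) = u - v :=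
    Γ.apply_of_mem x _ (by change mfderiv IN IS p x (u - v) = 0; rw [map_sub, h, sub_self])
  rw [map_sub, Γ.toFun_eq_zero hu, Γ.toFun_eq_zero hv, sub_zero] at h1
  exact sub_eq_zero.1 h1.symm

lemma lift_mem_hor (X : ∀ s : S, TangentSpace IS s) (x : N) : Γ.lift hp X x ∈ Γ.hor x :=
  ((Γ.horEquiv hp x).symm (X (p x))).2

lemma mfderiv_lift (X : ∀ s : S, TangentSpace IS s) (x : N) :
    mfderiv IN IS p x (Γ.lift hp X x) = X (p x) :=
  (Γ.horEquiv hp x).apply_symm_apply (X (p x))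

variable [IsManifold IS ∞ S]

variable [FiniteDimensional ℝ EN] [T2Space N] [FiniteDimensional ℝ ES] [T2Space S]

/-- The horizontal lift of a smooth vector field is smooth: near a point it is a combination of
horizontal fields that project at this point to a coordinate frame of the base. -/
theorem isSmoothVectorField_lift (hps : ContMDiff IN IS ∞ p) {X : ∀ s : S, TangentSpace IS s}
    (hX : IsSmoothVectorField IS X) : IsSmoothVectorField IN (Γ.lift hp X) := by
  intro x₀
  obtain ⟨c⟩ := nonempty_localCoords (I := IS) (p x₀)
  choose u hu using fun i => hp x₀ (c.frame i (p x₀))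
  choose Y hY hYx using fun i => exists_vectorField_eq (I := IN) x₀ (u i)
  have hco : ∀ i, IsSmoothFunction IN (c.coord i ∘ p) := fun i => (c.smooth_coord i).comp hps
  let B : N → Matrix (Fin (Module.finrank ℝ ES)) (Fin (Module.finrank ℝ ES)) ℝ :=
    fun x => Matrix.of fun i j => derivAlong IN (Y j) (c.coord i ∘ p) x
  have hB1 : B x₀ = 1 := by
    ext i j
    simp only [B, Matrix.of_apply, derivAlong]
    rw [differential_comp hps (c.smooth_coord i), hYx, hu, c.dual _ c.χ_self_ne, Matrix.one_apply]
  refine contMDiffAt_of_linear_system (B := B) (fun i j => (hco i).derivAlong (hY j))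
    (b := fun i => derivAlong IS X (c.coord i) ∘ p)
    (fun i => ((c.smooth_coord i).derivAlong hX).comp hps)
    (w := fun j => Γ.horPart (Y j)) (fun j => (hY j).horPart) (by rw [hB1]; simp) ?_
  filter_upwards [hps.continuous.continuousAt.eventually c.eventually] with x hx hdet
  set b : Fin (Module.finrank ℝ ES) → ℝ := fun i => (derivAlong IS X (c.coord i) ∘ p) x with hb
  set a := (B x)⁻¹.mulVec b with ha
  have hBa : (B x).mulVec a = b := by
    rw [ha, Matrix.mulVec_mulVec, Matrix.mul_nonsing_inv _ (isUnit_iff_ne_zero.2 hdet),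
      Matrix.one_mulVec]
  refine Γ.eq_of_mem_hor (Γ.lift_mem_hor hp X x)
    (Submodule.sum_mem _ fun j _ => Submodule.smul_mem _ _ (Γ.horPart_mem_hor (Y j) x)) ?_
  rw [mfderiv_lift, c.expand _ hx (X (p x)), c.expand _ hx (mfderiv IN IS p x _)]
  refine Finset.sum_congr rfl fun i _ => congrArg (· • c.frame i (p x)) ?_
  change b i = _
  rw [← hBa]
  simp only [map_sum, map_smul, Matrix.mulVec, dotProduct, horPart, mfderiv_sub_toFun]
  refine Finset.sum_congr rfl fun j _ => ?_
  simp only [B, Matrix.of_apply, derivAlong]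
  rw [differential_comp hps (c.smooth_coord i), smul_eq_mul, mul_comm]

end EhresmannConnection

namespace GeometricData

variable [IsManifold IS ∞ S] {σ : S → N} {Ω : ∀ s : S, LinearMap.BilinForm ℝ (TangentSpace IS s)}
  (D : GeometricData IN IS p σ Ω) (hp : ∀ x, Function.Surjective (mfderiv IN IS p x))

lemma couplingForm_apply (x : N) (u v : TangentSpace IN x) :
    D.couplingForm x u v = D.φ x (mfderiv IN IS p x u) (mfderiv IN IS p x v) := rfl

lemma couplingForm_self (x : N) (u : TangentSpace IN x) : D.couplingForm x u u = 0 :=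
  D.φ_alt x _

lemma couplingForm_swap (x : N) (u v : TangentSpace IN x) :
    D.couplingForm x u v = -D.couplingForm x v u :=
  ((D.φ_alt x).neg_eq _ _).symm

lemma couplingForm_sub_toFun (x : N) (u v : TangentSpace IN x) :
    D.couplingForm x u (v - D.Γ.toFun x v) = D.couplingForm x u v := by
  rw [couplingForm_apply, D.Γ.mfderiv_sub_toFun, couplingForm_apply]

lemma couplingForm_of_mem_vert {x : N} (u : TangentSpace IN x) {v : TangentSpace IN x}
    (hv : mfderiv IN IS p x v = 0) : D.couplingForm x u v = 0 := by
  rw [couplingForm_apply, hv, map_zero]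

lemma couplingForm_lift (X Y : ∀ s : S, TangentSpace IS s) (x : N) :
    D.couplingForm x (D.Γ.lift hp X x) (D.Γ.lift hp Y x) = D.φ x (X (p x)) (Y (p x)) := by
  rw [couplingForm_apply, D.Γ.mfderiv_lift, D.Γ.mfderiv_lift]

section

variable [FiniteDimensional ℝ ES] [T2Space S]

theorem isSmoothFunction_couplingForm (hps : ContMDiff IN IS ∞ p)
    {A B : ∀ x : N, TangentSpace IN x}
    (hA : IsSmoothVectorField IN A) (hB : IsSmoothVectorField IN B) :
    IsSmoothFunction IN (fun x => D.couplingForm x (A x) (B x)) := by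
  intro x₀
  obtain ⟨c⟩ := nonempty_localCoords (I := IS) (p x₀)
  have hco : ∀ i, IsSmoothFunction IN (c.coord i ∘ p) := fun i => (c.smooth_coord i).comp hps
  have h1 : IsSmoothFunction IN (fun x => ∑ i, derivAlong IN A (c.coord i ∘ p) x *
      ∑ j, derivAlong IN B (c.coord j ∘ p) x * D.φ x (c.frame i (p x)) (c.frame j (p x))) :=
    contMDiff_finsetSum fun i _ => ((hco i).derivAlong hA).mul
      (contMDiff_finsetSum fun j _ => ((hco j).derivAlong hB).mul
        (D.φ_smooth _ _ (c.smooth_frame i) (c.smooth_frame j)))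
  refine (h1 x₀).congr_of_eventuallyEq ?_
  filter_upwards [hps.continuous.continuousAt.eventually c.eventually] with x hx
  rw [couplingForm_apply, c.expand _ hx (mfderiv IN IS p x (A x)),
    c.expand _ hx (mfderiv IN IS p x (B x))]
  simp only [map_sum, map_smul, LinearMap.sum_apply, LinearMap.smul_apply, smul_eq_mul, derivAlong]
  simp only [differential_comp hps (c.smooth_coord _)]
  simp only [Finset.mul_sum]
  rw [Finset.sum_comm]
  refine Finset.sum_congr rfl fun i _ => Finset.sum_congr rfl fun j _ => ?_
  ring

end

variable [FiniteDimensional ℝ EN]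

lemma μ_mem_hor (x : N) (α : Module.Dual ℝ (TangentSpace IN x)) : D.μ hp x α ∈ D.Γ.hor x :=
  (((D.horForm x).toDual (D.horForm_nondegenerate hp x)).symm
    ((D.Γ.hor x).subtype.dualMap α)).2

lemma couplingForm_μ (x : N) (α : Module.Dual ℝ (TangentSpace IN x)) {v : TangentSpace IN x}
    (hv : v ∈ D.Γ.hor x) : D.couplingForm x (D.μ hp x α) v = α v :=
  LinearMap.BilinForm.apply_toDual_symm_apply (hB := D.horForm_nondegenerate hp x)
    ((D.Γ.hor x).subtype.dualMap α) ⟨v, hv⟩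

lemma apply_μ_swap (x : N) (α β : Module.Dual ℝ (TangentSpace IN x)) :
    β (D.μ hp x α) = D.couplingForm x (D.μ hp x β) (D.μ hp x α) :=
  (D.couplingForm_μ hp x β (D.μ_mem_hor hp x α)).symm

variable [T2Space N] [FiniteDimensional ℝ ES] [T2Space S]

/-- The horizontal field `μ α` is smooth: its coefficients in a horizontal lift of a coordinate
frame are obtained from those of `α` by inverting the matrix of `φ`. -/
theorem isSmoothVectorField_μ (hps : ContMDiff IN IS ∞ p)
    {α : ∀ x : N, Module.Dual ℝ (TangentSpace IN x)} (hα : IsSmoothOneForm IN α) :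
    IsSmoothVectorField IN (fun x => D.μ hp x (α x)) := by
  intro x₀
  obtain ⟨c⟩ := nonempty_localCoords (I := IS) (p x₀)
  have hlift : ∀ i, IsSmoothVectorField IN (D.Γ.lift hp (c.frame i)) := fun i =>
    D.Γ.isSmoothVectorField_lift hp hps (c.smooth_frame i)
  let B : N → Matrix (Fin (Module.finrank ℝ ES)) (Fin (Module.finrank ℝ ES)) ℝ :=
    fun x => Matrix.of fun i j => D.φ x (c.frame j (p x)) (c.frame i (p x))
  have hdet : (B x₀).det ≠ 0 := by
    intro h0
    obtain ⟨v, hv, hBv⟩ := Matrix.exists_mulVec_eq_zero_iff.2 h0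
    apply hv
    have h1 : ∑ j, v j • c.frame j (p x₀) = 0 := by
      refine (D.φ_nondegenerate x₀).1 _ fun w => ?_
      rw [c.expand _ c.χ_self_ne w, map_sum]
      refine Finset.sum_eq_zero fun i _ => ?_
      have h2 := congrFun hBv i
      simp only [B, Matrix.mulVec, dotProduct, Matrix.of_apply, Pi.zero_apply] at h2
      simp only [map_smul, map_sum, LinearMap.sum_apply, LinearMap.smul_apply, smul_eq_mul]
      rw [← mul_zero, ← h2]
      congr 1
      exact Finset.sum_congr rfl fun j _ => mul_comm _ _
    ext i
    have h3 := congrArg (differential IS (c.coord i) (p x₀)) h1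
    simpa [c.dual _ c.χ_self_ne] using h3
  refine contMDiffAt_of_linear_system (B := B)
    (fun i j => D.φ_smooth _ _ (c.smooth_frame j) (c.smooth_frame i))
    (b := fun i x => α x (D.Γ.lift hp (c.frame i) x)) (fun i => hα _ (hlift i))
    (w := fun j => D.Γ.lift hp (c.frame j)) hlift hdet ?_
  filter_upwards [hps.continuous.continuousAt.eventually c.eventually] with x hx hdetx
  let a : Fin (Module.finrank ℝ ES) → ℝ := fun j =>
    differential IS (c.coord j) (p x) (mfderiv IN IS p x (D.μ hp x (α x)))
  have hexp : D.μ hp x (α x) = ∑ j, a j • D.Γ.lift hp (c.frame j) x := by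
    refine D.Γ.eq_of_mem_hor (D.μ_mem_hor hp x _)
      (Submodule.sum_mem _ fun j _ => Submodule.smul_mem _ _ (D.Γ.lift_mem_hor hp _ x)) ?_
    simp only [map_sum, map_smul, D.Γ.mfderiv_lift]
    exact c.expand _ hx _
  have hBa : (B x).mulVec a = fun i => α x (D.Γ.lift hp (c.frame i) x) := by
    ext i
    rw [← D.couplingForm_μ hp x (α x) (D.Γ.lift_mem_hor hp _ x), hexp]
    simp only [map_sum, map_smul, LinearMap.sum_apply, LinearMap.smul_apply, smul_eq_mul,
      couplingForm_lift, Matrix.mulVec, dotProduct, B, Matrix.of_apply]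
    exact Finset.sum_congr rfl fun j _ => mul_comm _ _
  rw [← hBa, Matrix.mulVec_mulVec, Matrix.nonsing_inv_mul _ (isUnit_iff_ne_zero.2 hdetx),
    Matrix.one_mulVec]
  exact hexp

lemma isBivectorField_μ (hps : ContMDiff IN IS ∞ p) : IsBivectorField IN (D.μ hp) where
  alt x α := by rw [D.apply_μ_swap, D.couplingForm_self]
  smooth _ _ hα hβ := hβ _ (D.isSmoothVectorField_μ hp hps hα)

end GeometricData

end Submersion

/-! ### Brackets of functions defined by bivector fields -/

section Bivector

variable {E : Type*} [NormedAddCommGroup E] [NormedSpace ℝ E] {H : Type*} [TopologicalSpace H]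
  (I : ModelWithCorners ℝ E H) {M : Type*} [TopologicalSpace M] [ChartedSpace H M]

/-- The Hamiltonian vector field `Λ(df, ·)` of a function. -/
def hamiltonian (Λ : ∀ x : M, Module.Dual ℝ (TangentSpace I x) →ₗ[ℝ] TangentSpace I x)
    (f : M → ℝ) (x : M) : TangentSpace I x :=
  Λ x (differential I f x)

/-- The Jacobiator `{{f, g}, h} + {{g, h}, f} + {{h, f}, g}` of the bracket of functions defined by
a bivector field. -/
def jacobiator (Λ : ∀ x : M, Module.Dual ℝ (TangentSpace I x) →ₗ[ℝ] TangentSpace I x)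
    (f g h : M → ℝ) (x : M) : ℝ :=
  pairing I Λ (pairing I Λ f g) h x + pairing I Λ (pairing I Λ g h) f x
    + pairing I Λ (pairing I Λ h f) g x

variable {I} {Λ Λ' : ∀ x : M, Module.Dual ℝ (TangentSpace I x) →ₗ[ℝ] TangentSpace I x}

lemma schouten_self_eq (f g h : M → ℝ) (x : M) :
    schouten I Λ Λ f g h x = 2 * jacobiator I Λ f g h x := by
  simp only [schouten, jacobiator]
  ring

lemma jacobiator_rotate (f g h : M → ℝ) (x : M) :
    jacobiator I Λ f g h x = jacobiator I Λ g h f x := by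
  simp only [jacobiator]
  ring

lemma pairing_add_right {f g g' : M → ℝ} (hg : IsSmoothFunction I g)
    (hg' : IsSmoothFunction I g') :
    pairing I Λ f (g + g') = pairing I Λ f g + pairing I Λ f g' := by
  ext x
  simp [pairing, differential_add hg hg']

lemma pairing_neg_right (f g : M → ℝ) : pairing I Λ f (-g) = -pairing I Λ f g := by
  ext x
  simp [pairing, differential_neg]

lemma pairing_add_left {f f' g : M → ℝ} (hf : IsSmoothFunction I f)
    (hf' : IsSmoothFunction I f') :
    pairing I Λ (f + f') g = pairing I Λ f g + pairing I Λ f' g := by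
  ext x
  simp [pairing, differential_add hf hf']

lemma pairing_add_bivector (f g : M → ℝ) :
    pairing I (fun x => Λ x + Λ' x) f g = pairing I Λ f g + pairing I Λ' f g := by
  ext x
  simp [pairing]

lemma schoutenVector_eq (X : ∀ x : M, TangentSpace I x) (f g : M → ℝ) (x : M) :
    schoutenVector I X Λ f g x = derivAlong I X (pairing I Λ f g) x
      - pairing I Λ (derivAlong I X f) g x - pairing I Λ f (derivAlong I X g) x := rfl

variable [IsManifold I ∞ M]

namespace IsBivectorField

lemma apply_swap (hΛ : IsBivectorField I Λ) (x : M) (α β : Module.Dual ℝ (TangentSpace I x)) :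
    β (Λ x α) = -α (Λ x β) := by
  have h := hΛ.alt x (α + β)
  simp only [map_add, LinearMap.add_apply, hΛ.alt] at h
  linarith

lemma pairing_swap (hΛ : IsBivectorField I Λ) (f g : M → ℝ) :
    pairing I Λ f g = -pairing I Λ g f :=
  funext fun x => hΛ.apply_swap x _ _

lemma isSmoothFunction_pairing (hΛ : IsBivectorField I Λ) {f g : M → ℝ}
    (hf : IsSmoothFunction I f) (hg : IsSmoothFunction I g) :
    IsSmoothFunction I (pairing I Λ f g) :=
  hΛ.smooth _ _ (isSmoothOneForm_differential hf) (isSmoothOneForm_differential hg)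

lemma add (hΛ : IsBivectorField I Λ) (hΛ' : IsBivectorField I Λ') :
    IsBivectorField I (fun x => Λ x + Λ' x) where
  alt x α := by simp [hΛ.alt, hΛ'.alt]
  smooth α β hα hβ := by
    simp only [LinearMap.add_apply, map_add]
    exact (hΛ.smooth α β hα hβ).add (hΛ'.smooth α β hα hβ)

lemma jacobiator_add (hΛ : IsBivectorField I Λ) {f f' g h : M → ℝ} (hf : IsSmoothFunction I f)
    (hf' : IsSmoothFunction I f') (hg : IsSmoothFunction I g) (hh : IsSmoothFunction I h) (x : M) :
    jacobiator I Λ (f + f') g h x = jacobiator I Λ f g h x + jacobiator I Λ f' g h x := by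
  simp only [jacobiator]
  rw [pairing_add_left hf hf', pairing_add_right hf hf', pairing_add_right hf hf',
    pairing_add_left (hΛ.isSmoothFunction_pairing hf hg) (hΛ.isSmoothFunction_pairing hf' hg),
    pairing_add_left (hΛ.isSmoothFunction_pairing hh hf) (hΛ.isSmoothFunction_pairing hh hf')]
  simp only [Pi.add_apply]
  ring

/-- As a function of `g` and `h`, the Jacobiator is minus the Lie derivative of the bivector along
the Hamiltonian field of `f`. -/
lemma jacobiator_eq_neg_schoutenVector (hΛ : IsBivectorField I Λ) (f g h : M → ℝ) (x : M) :
    jacobiator I Λ f g h x = -schoutenVector I (hamiltonian I Λ f) Λ g h x := by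
  have h1 : pairing I Λ (pairing I Λ h f) g x = pairing I Λ g (pairing I Λ f h) x := by
    rw [hΛ.pairing_swap h f, hΛ.pairing_swap _ g, pairing_neg_right]
    simp
  have h2 : pairing I Λ (pairing I Λ g h) f x = -pairing I Λ f (pairing I Λ g h) x := by
    rw [hΛ.pairing_swap _ f]
    rfl
  rw [jacobiator, h1, h2, schoutenVector]
  change pairing I Λ (pairing I Λ f g) h x + -pairing I Λ f (pairing I Λ g h) x
    + pairing I Λ g (pairing I Λ f h) x = -(pairing I Λ f (pairing I Λ g h) x
    - pairing I Λ (pairing I Λ f g) h x - pairing I Λ g (pairing I Λ f h) x)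
  ring

lemma schoutenVector_swap (hΛ : IsBivectorField I Λ) (X : ∀ x : M, TangentSpace I x)
    (f g : M → ℝ) (x : M) : schoutenVector I X Λ f g x = -schoutenVector I X Λ g f x := by
  simp only [schoutenVector]
  rw [hΛ.pairing_swap f g, differential_neg, hΛ.pairing_swap _ g, hΛ.pairing_swap f]
  simp only [LinearMap.neg_apply, Pi.neg_apply]
  ring

lemma schoutenVector_add_left (hΛ : IsBivectorField I Λ) {X : ∀ x : M, TangentSpace I x}
    (hX : IsSmoothVectorField I X) {f f' g : M → ℝ} (hf : IsSmoothFunction I f)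
    (hf' : IsSmoothFunction I f') (hg : IsSmoothFunction I g) (x : M) :
    schoutenVector I X Λ (f + f') g x
      = schoutenVector I X Λ f g x + schoutenVector I X Λ f' g x := by
  simp only [schoutenVector_eq]
  rw [derivAlong_add_fun X hf hf', pairing_add_left hf hf', pairing_add_left hf hf',
    derivAlong_add_fun X (hΛ.isSmoothFunction_pairing hf hg) (hΛ.isSmoothFunction_pairing hf' hg),
    pairing_add_left (hf.derivAlong hX) (hf'.derivAlong hX)]
  simp only [Pi.add_apply]
  ring

lemma schoutenVector_add_bivector (hΛ : IsBivectorField I Λ) (hΛ' : IsBivectorField I Λ')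
    (X : ∀ x : M, TangentSpace I x) {f g : M → ℝ} (hf : IsSmoothFunction I f)
    (hg : IsSmoothFunction I g) (x : M) :
    schoutenVector I X (fun x => Λ x + Λ' x) f g x
      = schoutenVector I X Λ f g x + schoutenVector I X Λ' f g x := by
  simp only [schoutenVector, pairing_add_bivector]
  rw [differential_add (hΛ.isSmoothFunction_pairing hf hg) (hΛ'.isSmoothFunction_pairing hf hg)]
  simp only [LinearMap.add_apply, Pi.add_apply]
  ring

variable [FiniteDimensional ℝ E] [T2Space M]

lemma isSmoothVectorField_hamiltonian (hΛ : IsBivectorField I Λ) {f : M → ℝ}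
    (hf : IsSmoothFunction I f) : IsSmoothVectorField I (hamiltonian I Λ f) :=
  isSmoothVectorField_of_forall fun _ hk => hΛ.isSmoothFunction_pairing hf hk

/-- The Jacobiator measures the failure of `f ↦ Λ(df, ·)` to be compatible with brackets. -/
lemma jacobiator_eq_sub_mlieBracket (hΛ : IsBivectorField I Λ) {f g h : M → ℝ}
    (hf : IsSmoothFunction I f) (hg : IsSmoothFunction I g) (hh : IsSmoothFunction I h) (x : M) :
    jacobiator I Λ f g h x = differential I h x (hamiltonian I Λ (pairing I Λ f g) x)
      - differential I h x (mlieBracket I (hamiltonian I Λ f) (hamiltonian I Λ g) x) := by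
  have h1 := derivAlong_mlieBracket (hΛ.isSmoothVectorField_hamiltonian hf)
    (hΛ.isSmoothVectorField_hamiltonian hg) hh x
  rw [hΛ.jacobiator_eq_neg_schoutenVector, schoutenVector]
  change -(pairing I Λ f (pairing I Λ g h) x - pairing I Λ (pairing I Λ f g) h x
    - pairing I Λ g (pairing I Λ f h) x) = pairing I Λ (pairing I Λ f g) h x -
      derivAlong I (mlieBracket I (hamiltonian I Λ f) (hamiltonian I Λ g)) h x
  rw [h1]
  change _ = _ - (pairing I Λ f (pairing I Λ g h) x - pairing I Λ g (pairing I Λ f h) x)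
  ring

end IsBivectorField

end Bivector

section GeometricData

set_option linter.unusedSectionVars false

variable {EN : Type*} [NormedAddCommGroup EN] [NormedSpace ℝ EN] [FiniteDimensional ℝ EN]
  {HN : Type*} [TopologicalSpace HN] {IN : ModelWithCorners ℝ EN HN}
  {N : Type*} [TopologicalSpace N] [ChartedSpace HN N] [IsManifold IN ∞ N] [T2Space N]
  {ES : Type*} [NormedAddCommGroup ES] [NormedSpace ℝ ES] [FiniteDimensional ℝ ES]
  {HS : Type*} [TopologicalSpace HS] {IS : ModelWithCorners ℝ ES HS}
  {S : Type*} [TopologicalSpace S] [ChartedSpace HS S] [IsManifold IS ∞ S] [T2Space S] {p : N → S}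

/-! ### Lie brackets and the projection -/

section Projection

lemma derivAlong_comp_of_mfderiv_eq (hps : ContMDiff IN IS ∞ p) {A : ∀ x : N, TangentSpace IN x}
    {X : ∀ s : S, TangentSpace IS s} (h : ∀ x, mfderiv IN IS p x (A x) = X (p x)) {F : S → ℝ}
    (hF : IsSmoothFunction IS F) : derivAlong IN A (F ∘ p) = derivAlong IS X F ∘ p := by
  ext x
  rw [derivAlong, differential_comp hps hF, h]
  rfl

/-- Brackets of `p`-related vector fields are `p`-related. -/
lemma mfderiv_mlieBracket (hps : ContMDiff IN IS ∞ p) {A B : ∀ x : N, TangentSpace IN x}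
    {X Y : ∀ s : S, TangentSpace IS s} (hA : IsSmoothVectorField IN A)
    (hB : IsSmoothVectorField IN B) (hX : IsSmoothVectorField IS X)
    (hY : IsSmoothVectorField IS Y) (hAX : ∀ x, mfderiv IN IS p x (A x) = X (p x))
    (hBY : ∀ x, mfderiv IN IS p x (B x) = Y (p x)) (x : N) :
    mfderiv IN IS p x (mlieBracket IN A B x) = mlieBracket IS X Y (p x) := by
  refine eq_of_forall_differential fun F hF => ?_
  rw [← differential_comp hps hF]
  change derivAlong IN (mlieBracket IN A B) (F ∘ p) x = derivAlong IS (mlieBracket IS X Y) F (p x)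
  rw [derivAlong_mlieBracket hA hB (hF.comp hps), derivAlong_mlieBracket hX hY hF,
    derivAlong_comp_of_mfderiv_eq hps hAX hF, derivAlong_comp_of_mfderiv_eq hps hBY hF,
    derivAlong_comp_of_mfderiv_eq hps hAX (hF.derivAlong hY),
    derivAlong_comp_of_mfderiv_eq hps hBY (hF.derivAlong hX)]
  rfl

end Projection

/-! ### Tensoriality in horizontal fields -/

section HorTensorial

variable (Γ : EhresmannConnection IN IS p)

/-- Operations on smooth horizontal vector fields that are linear over smooth functions at `x`. -/
structure HorTensorial (x : N) (Φ : (∀ y : N, TangentSpace IN y) → ℝ) : Prop where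
  add : ∀ A B, IsSmoothVectorField IN A → IsSmoothVectorField IN B → (∀ y, A y ∈ Γ.hor y) →
    (∀ y, B y ∈ Γ.hor y) → Φ (A + B) = Φ A + Φ B
  smul : ∀ f A, IsSmoothFunction IN f → IsSmoothVectorField IN A → (∀ y, A y ∈ Γ.hor y) →
    Φ (f • A) = f x * Φ A

variable {Γ} in
lemma HorTensorial.congr {x : N} {Φ : (∀ y : N, TangentSpace IN y) → ℝ}
    (hΦ : HorTensorial Γ x Φ) {A B : ∀ y : N, TangentSpace IN y} (hA : IsSmoothVectorField IN A)
    (hB : IsSmoothVectorField IN B) (hA' : ∀ y, A y ∈ Γ.hor y) (hB' : ∀ y, B y ∈ Γ.hor y)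
    (h : A x = B x) : Φ A = Φ B := by
  have key := tensorial_congr (Φ := fun A => Φ (Γ.horPart A)) (x := x)
    (fun A B hA hB => by
      rw [Γ.horPart_add]
      exact hΦ.add _ _ hA.horPart hB.horPart (Γ.horPart_mem_hor A) (Γ.horPart_mem_hor B))
    (fun f A hf hA => by
      rw [Γ.horPart_smul]
      exact hΦ.smul _ _ hf hA.horPart (Γ.horPart_mem_hor A)) hA hB h
  simpa only [Γ.horPart_eq_self hA', Γ.horPart_eq_self hB'] using key

end HorTensorial

/-! ### The coupling bivector on functions from the base -/

namespace GeometricData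

variable {σ : S → N} {Ω : ∀ s : S, LinearMap.BilinForm ℝ (TangentSpace IS s)}
  (D : GeometricData IN IS p σ Ω) (hp : ∀ x, Function.Surjective (mfderiv IN IS p x))
  (hps : ContMDiff IN IS ∞ p)

/-- The bivector field `π = μ + ν`. -/
def couplingBivector (x : N) : Module.Dual ℝ (TangentSpace IN x) →ₗ[ℝ] TangentSpace IN x := D.μ hp x + D.ν x

/-- The differential of `f` at `x` vanishes on the horizontal space. -/
def IsVerticalAt (x : N) (f : N → ℝ) : Prop := ∀ v ∈ D.Γ.hor x, differential IN f x v = 0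

/-- The Hamiltonian field of a function `F ∘ p` with respect to the horizontal bivector. -/
def basicField (F : S → ℝ) : ∀ x : N, TangentSpace IN x := hamiltonian IN (D.μ hp) (F ∘ p)

section Basic

include hps

lemma ν_differential_comp {F : S → ℝ} (hF : IsSmoothFunction IS F) (x : N) :
    D.ν x (differential IN (F ∘ p) x) = 0 := by
  refine eq_of_forall_differential fun k _ => ?_
  rw [D.isBivectorField_ν.apply_swap, differential_comp hps hF,
    show mfderiv IN IS p x (D.ν x _) = 0 from D.ν_mem_vert x _]
  simp

lemma pairing_ν_comp {F : S → ℝ} (hF : IsSmoothFunction IS F) (g : N → ℝ) :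
    pairing IN D.ν (F ∘ p) g = 0 := by
  ext x
  simp [pairing, D.ν_differential_comp hps hF]

lemma pairing_ν_comp_right {F : S → ℝ} (hF : IsSmoothFunction IS F) (g : N → ℝ) :
    pairing IN D.ν g (F ∘ p) = 0 := by
  rw [D.isBivectorField_ν.pairing_swap, D.pairing_ν_comp hps hF, neg_zero]

lemma hamiltonian_couplingBivector_comp {F : S → ℝ} (hF : IsSmoothFunction IS F) :
    hamiltonian IN (D.couplingBivector hp) (F ∘ p) = D.basicField hp F := by
  ext1 x
  simp [hamiltonian, couplingBivector, basicField, D.ν_differential_comp hps hF]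

lemma pairing_couplingBivector_comp {F : S → ℝ} (hF : IsSmoothFunction IS F) (g : N → ℝ) :
    pairing IN (D.couplingBivector hp) (F ∘ p) g = derivAlong IN (D.basicField hp F) g := by
  rw [← D.hamiltonian_couplingBivector_comp hp hps hF]
  rfl

lemma isBivectorField_couplingBivector : IsBivectorField IN (D.couplingBivector hp) :=
  (D.isBivectorField_μ hp hps).add D.isBivectorField_ν

lemma isSmoothVectorField_basicField {F : S → ℝ} (hF : IsSmoothFunction IS F) :
    IsSmoothVectorField IN (D.basicField hp F) :=
  (D.isBivectorField_μ hp hps).isSmoothVectorField_hamiltonian (hF.comp hps)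

omit hps in
lemma basicField_mem_hor (F : S → ℝ) (x : N) : D.basicField hp F x ∈ D.Γ.hor x :=
  D.μ_mem_hor hp x _

lemma couplingForm_basicField {F : S → ℝ} (hF : IsSmoothFunction IS F) (x : N)
    (v : TangentSpace IN x) :
    D.couplingForm x (D.basicField hp F x) v = differential IN (F ∘ p) x v := by
  rw [← D.couplingForm_sub_toFun, basicField, hamiltonian,
    D.couplingForm_μ hp x _ (D.Γ.sub_toFun_mem_hor x v), differential_comp hps hF,
    D.Γ.mfderiv_sub_toFun, ← differential_comp hps hF]

lemma derivAlong_basicField_swap {F G : S → ℝ} (hF : IsSmoothFunction IS F)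
    (hG : IsSmoothFunction IS G) :
    derivAlong IN (D.basicField hp F) (G ∘ p) = -derivAlong IN (D.basicField hp G) (F ∘ p) := by
  rw [← D.pairing_couplingBivector_comp hp hps hF, ← D.pairing_couplingBivector_comp hp hps hG,
    (D.isBivectorField_couplingBivector hp hps).pairing_swap]

lemma exists_basicField_eq {x : N} {v : TangentSpace IN x} (hv : v ∈ D.Γ.hor x) :
    ∃ F : S → ℝ, IsSmoothFunction IS F ∧ D.basicField hp F x = v := by
  obtain ⟨F, hF, hFx⟩ := exists_function_differential_eq (I := IS) (p x)
    (D.φ x (mfderiv IN IS p x v))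
  refine ⟨F, hF, D.Γ.eq_of_mem_hor (D.basicField_mem_hor hp F x) hv ?_⟩
  refine sub_eq_zero.1 ((D.φ_nondegenerate x).1 _ fun w => ?_)
  obtain ⟨u, rfl⟩ := hp x w
  rw [map_sub, LinearMap.sub_apply, ← couplingForm_apply,
    D.couplingForm_basicField hp hps hF, differential_comp hps hF, hFx, sub_self]

omit hps [FiniteDimensional ℝ EN] [T2Space N] in
lemma exists_lift_eq {x : N} {v : TangentSpace IN x} (hv : v ∈ D.Γ.hor x) :
    ∃ X : ∀ s : S, TangentSpace IS s, IsSmoothVectorField IS X ∧ D.Γ.lift hp X x = v := by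
  obtain ⟨X, hX, hXx⟩ := exists_vectorField_eq (I := IS) (p x) (mfderiv IN IS p x v)
  exact ⟨X, hX, D.Γ.eq_of_mem_hor (D.Γ.lift_mem_hor hp X x) hv (by rw [D.Γ.mfderiv_lift, hXx])⟩

include hp in
/-- At a given point, every function is the sum of a function from the base and a function whose
differential vanishes on the horizontal space. -/
lemma exists_eq_comp_add (x : N) {f : N → ℝ} (hf : IsSmoothFunction IN f) :
    ∃ (F : S → ℝ) (f' : N → ℝ), IsSmoothFunction IS F ∧ IsSmoothFunction IN f' ∧
      D.IsVerticalAt x f' ∧ f = F ∘ p + f' := by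
  obtain ⟨F, hF, hFx⟩ := exists_function_differential_eq (I := IS) (p x)
    (differential IN f x ∘ₗ (D.Γ.hor x).subtype ∘ₗ (D.Γ.horEquiv hp x).symm.toLinearMap)
  have hFp : IsSmoothFunction IN (F ∘ p) := hF.comp hps
  refine ⟨F, f - F ∘ p, hF, hf.sub hFp, fun v hv => ?_, by abel⟩
  rw [differential_sub hf hFp, LinearMap.sub_apply, differential_comp hps hF, hFx, sub_eq_zero]
  have h1 : (D.Γ.horEquiv hp x).symm (mfderiv IN IS p x v) = ⟨v, hv⟩ :=
    (D.Γ.horEquiv hp x).symm_apply_apply ⟨v, hv⟩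
  simp [h1]

end Basic

/-! ### The exterior derivative of the coupling form -/

section Closed

lemma extDeriv_rotate (A B C : ∀ x : N, TangentSpace IN x) (x : N) :
    extDerivTwoForm IN D.couplingForm A B C x = extDerivTwoForm IN D.couplingForm B C A x := by
  simp only [extDerivTwoForm]
  ring

include hps

lemma horTensorial_extDeriv {B C : ∀ x : N, TangentSpace IN x} (hB : IsSmoothVectorField IN B)
    (hC : IsSmoothVectorField IN C) (x : N) :
    HorTensorial D.Γ x (fun A => extDerivTwoForm IN D.couplingForm A B C x) where
  add A A' hA hA' _ _ := by
    have e1 : (fun y => D.couplingForm y (C y) ((A + A') y)) =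
        (fun y => D.couplingForm y (C y) (A y)) + fun y => D.couplingForm y (C y) (A' y) := by
      ext y; simp
    have e2 : (fun y => D.couplingForm y ((A + A') y) (B y)) =
        (fun y => D.couplingForm y (A y) (B y)) + fun y => D.couplingForm y (A' y) (B y) := by
      ext y; simp
    simp only [extDerivTwoForm]
    rw [e1, e2, differential_add (D.isSmoothFunction_couplingForm hps hC hA)
        (D.isSmoothFunction_couplingForm hps hC hA'),
      differential_add (D.isSmoothFunction_couplingForm hps hA hB)
        (D.isSmoothFunction_couplingForm hps hA' hB),
      mlieBracket_add_left (hA.mdiffAt x) (hA'.mdiffAt x),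
      mlieBracket_add_right (hA.mdiffAt x) (hA'.mdiffAt x)]
    simp only [Pi.add_apply, map_add, LinearMap.add_apply]
    ring
  smul f A hf hA _ := by
    have e1 : (fun y => D.couplingForm y (C y) ((f • A) y)) =
        f * fun y => D.couplingForm y (C y) (A y) := by
      ext y; simp
    have e2 : (fun y => D.couplingForm y ((f • A) y) (B y)) =
        f * fun y => D.couplingForm y (A y) (B y) := by
      ext y; simp
    have h1 : mlieBracket IN (f • A) B x
        = -differential IN f x (B x) • A x + f x • mlieBracket IN A B x :=
      mlieBracket_smul_left (hf.mdiffAt x) (hA.mdiffAt x)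
    have h2 : mlieBracket IN C (f • A) x
        = differential IN f x (C x) • A x + f x • mlieBracket IN C A x :=
      mlieBracket_smul_right (hf.mdiffAt x) (hA.mdiffAt x)
    simp only [extDerivTwoForm]
    rw [e1, e2, differential_mul hf (D.isSmoothFunction_couplingForm hps hC hA),
      differential_mul hf (D.isSmoothFunction_couplingForm hps hA hB), h1, h2]
    simp only [Pi.smul_apply', map_add, map_smul, LinearMap.add_apply, LinearMap.smul_apply,
      smul_eq_mul, neg_smul, map_neg, LinearMap.neg_apply]
    rw [D.couplingForm_swap x (C x) (A x)]
    ring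

/-- On Hamiltonian fields of functions from the base, the exterior derivative of the coupling form
is the Jacobiator. -/
lemma extDeriv_basicField {F G K : S → ℝ} (hF : IsSmoothFunction IS F)
    (hG : IsSmoothFunction IS G) (hK : IsSmoothFunction IS K) (x : N) :
    extDerivTwoForm IN D.couplingForm (D.basicField hp F) (D.basicField hp G)
        (D.basicField hp K) x
      = -jacobiator IN (D.couplingBivector hp) (F ∘ p) (G ∘ p) (K ∘ p) x := by
  have e : ∀ {A B : S → ℝ}, IsSmoothFunction IS A → IsSmoothFunction IS B →
      (fun y => D.couplingForm y (D.basicField hp A y) (D.basicField hp B y))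
        = -pairing IN (D.couplingBivector hp) (A ∘ p) (B ∘ p) := by
    intro A B hA hB
    rw [D.pairing_couplingBivector_comp hp hps hA, D.derivAlong_basicField_swap hp hps hA hB, neg_neg]
    ext y
    exact D.couplingForm_basicField hp hps hA y _
  have b : ∀ {A B C : S → ℝ}, IsSmoothFunction IS A → IsSmoothFunction IS B →
      IsSmoothFunction IS C →
      D.couplingForm x (mlieBracket IN (D.basicField hp A) (D.basicField hp B) x)
        (D.basicField hp C x)
        = pairing IN (D.couplingBivector hp) (B ∘ p) (pairing IN (D.couplingBivector hp) (A ∘ p) (C ∘ p)) x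
          - pairing IN (D.couplingBivector hp) (A ∘ p) (pairing IN (D.couplingBivector hp) (B ∘ p) (C ∘ p)) x := by
    intro A B C hA hB hC
    rw [D.couplingForm_swap, D.couplingForm_basicField hp hps hC]
    change -derivAlong IN (mlieBracket IN (D.basicField hp A) (D.basicField hp B)) (C ∘ p) x = _
    rw [derivAlong_mlieBracket (D.isSmoothVectorField_basicField hp hps hA)
      (D.isSmoothVectorField_basicField hp hps hB) (hC.comp hps)]
    simp only [D.pairing_couplingBivector_comp hp hps hA, D.pairing_couplingBivector_comp hp hps hB]
    ring
  have q : ∀ {A : S → ℝ} (u : N → ℝ), IsSmoothFunction IS A →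
      differential IN u x (D.basicField hp A x) = pairing IN (D.couplingBivector hp) (A ∘ p) u x := by
    intro A u hA
    rw [D.pairing_couplingBivector_comp hp hps hA]
    rfl
  have hπ := D.isBivectorField_couplingBivector hp hps
  have s : ∀ a b c : N → ℝ, pairing IN (D.couplingBivector hp) (pairing IN (D.couplingBivector hp) a b) c x
      = -pairing IN (D.couplingBivector hp) c (pairing IN (D.couplingBivector hp) a b) x := by
    intro a b c
    rw [hπ.pairing_swap _ c]
    rfl
  have t : ∀ a b c : N → ℝ, pairing IN (D.couplingBivector hp) a (pairing IN (D.couplingBivector hp) b c) x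
      = -pairing IN (D.couplingBivector hp) a (pairing IN (D.couplingBivector hp) c b) x := by
    intro a b c
    rw [hπ.pairing_swap b c, pairing_neg_right]
    rfl
  simp only [extDerivTwoForm, jacobiator]
  rw [e hG hK, e hK hF, e hF hG, b hF hG hK, b hG hK hF, b hK hF hG, q _ hF, q _ hG, q _ hK,
    s, s, s, pairing_neg_right, pairing_neg_right, pairing_neg_right]
  simp only [Pi.neg_apply]
  rw [t (F ∘ p) (K ∘ p), t (G ∘ p) (F ∘ p), t (K ∘ p) (G ∘ p)]
  ring

/-- The coupling form is closed on horizontal lifts if and only if the Jacobiator vanishes on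
functions from the base. -/
lemma extDeriv_lift_iff (x : N) :
    (∀ X₁ X₂ X₃ : ∀ s : S, TangentSpace IS s, IsSmoothVectorField IS X₁ →
      IsSmoothVectorField IS X₂ → IsSmoothVectorField IS X₃ →
      extDerivTwoForm IN D.couplingForm (D.Γ.lift hp X₁) (D.Γ.lift hp X₂) (D.Γ.lift hp X₃) x = 0)
    ↔ ∀ F G K : S → ℝ, IsSmoothFunction IS F → IsSmoothFunction IS G → IsSmoothFunction IS K →
      jacobiator IN (D.couplingBivector hp) (F ∘ p) (G ∘ p) (K ∘ p) x = 0 := by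
  have key : ∀ {A B C A' B' C' : ∀ x : N, TangentSpace IN x},
      IsSmoothVectorField IN A → IsSmoothVectorField IN B → IsSmoothVectorField IN C →
      IsSmoothVectorField IN A' → IsSmoothVectorField IN B' → IsSmoothVectorField IN C' →
      (∀ y, A y ∈ D.Γ.hor y) → (∀ y, B y ∈ D.Γ.hor y) → (∀ y, C y ∈ D.Γ.hor y) →
      (∀ y, A' y ∈ D.Γ.hor y) → (∀ y, B' y ∈ D.Γ.hor y) → (∀ y, C' y ∈ D.Γ.hor y) →
      A x = A' x → B x = B' x → C x = C' x →
      extDerivTwoForm IN D.couplingForm A B C x = extDerivTwoForm IN D.couplingForm A' B' C' x := by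
    intro A B C A' B' C' hA hB hC hA' hB' hC' a b c a' b' c' e₁ e₂ e₃
    rw [(D.horTensorial_extDeriv hps hB hC x).congr hA hA' a a' e₁, D.extDeriv_rotate,
      (D.horTensorial_extDeriv hps hC hA' x).congr hB hB' b b' e₂, D.extDeriv_rotate,
      (D.horTensorial_extDeriv hps hA' hB' x).congr hC hC' c c' e₃, D.extDeriv_rotate]
  have hl : ∀ {X : ∀ s : S, TangentSpace IS s}, IsSmoothVectorField IS X →
      IsSmoothVectorField IN (D.Γ.lift hp X) := D.Γ.isSmoothVectorField_lift hp hps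
  constructor
  · intro h F G K hF hG hK
    obtain ⟨X₁, h₁, e₁⟩ := D.exists_lift_eq hp (D.basicField_mem_hor hp F x)
    obtain ⟨X₂, h₂, e₂⟩ := D.exists_lift_eq hp (D.basicField_mem_hor hp G x)
    obtain ⟨X₃, h₃, e₃⟩ := D.exists_lift_eq hp (D.basicField_mem_hor hp K x)
    rw [← neg_eq_zero, ← D.extDeriv_basicField hp hps hF hG hK, ← h X₁ X₂ X₃ h₁ h₂ h₃]
    exact key (D.isSmoothVectorField_basicField hp hps hF)
      (D.isSmoothVectorField_basicField hp hps hG) (D.isSmoothVectorField_basicField hp hps hK)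
      (hl h₁) (hl h₂) (hl h₃) (D.basicField_mem_hor hp F) (D.basicField_mem_hor hp G)
      (D.basicField_mem_hor hp K) (D.Γ.lift_mem_hor hp X₁) (D.Γ.lift_mem_hor hp X₂)
      (D.Γ.lift_mem_hor hp X₃) e₁.symm e₂.symm e₃.symm
  · intro h X₁ X₂ X₃ h₁ h₂ h₃
    obtain ⟨F, hF, e₁⟩ := D.exists_basicField_eq hp hps (D.Γ.lift_mem_hor hp X₁ x)
    obtain ⟨G, hG, e₂⟩ := D.exists_basicField_eq hp hps (D.Γ.lift_mem_hor hp X₂ x)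
    obtain ⟨K, hK, e₃⟩ := D.exists_basicField_eq hp hps (D.Γ.lift_mem_hor hp X₃ x)
    rw [← neg_eq_zero.2 (h F G K hF hG hK), ← D.extDeriv_basicField hp hps hF hG hK]
    exact key (hl h₁) (hl h₂) (hl h₃) (D.isSmoothVectorField_basicField hp hps hF)
      (D.isSmoothVectorField_basicField hp hps hG) (D.isSmoothVectorField_basicField hp hps hK)
      (D.Γ.lift_mem_hor hp X₁) (D.Γ.lift_mem_hor hp X₂) (D.Γ.lift_mem_hor hp X₃)
      (D.basicField_mem_hor hp F) (D.basicField_mem_hor hp G) (D.basicField_mem_hor hp K)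
      e₁.symm e₂.symm e₃.symm

end Closed

/-! ### The curvature identity -/

section Curvature

/-- The defect `dk(Γ[A, B]) + (L_V ω̂)(A, B)`, where `V = ν dk`, as an operation on horizontal vector
fields `A`, `B`. It is tensorial, and vanishes on horizontal lifts for all `k` exactly if the
curvature identity holds. -/
def curvatureDefect (k : N → ℝ) (A B : ∀ x : N, TangentSpace IN x) (x : N) : ℝ :=
  differential IN k x (D.Γ.toFun x (mlieBracket IN A B x))
    + derivAlong IN (hamiltonian IN D.ν k) (fun y => D.couplingForm y (A y) (B y)) x
    - D.couplingForm x (mlieBracket IN (hamiltonian IN D.ν k) A x) (B x)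
    - D.couplingForm x (A x) (mlieBracket IN (hamiltonian IN D.ν k) B x)

lemma curvatureDefect_swap (k : N → ℝ) (A B : ∀ x : N, TangentSpace IN x) (x : N) :
    D.curvatureDefect k A B x = -D.curvatureDefect k B A x := by
  have h : (fun y => D.couplingForm y (A y) (B y)) = -fun y => D.couplingForm y (B y) (A y) :=
    funext fun y => D.couplingForm_swap y _ _
  simp only [curvatureDefect]
  rw [h, derivAlong_neg_fun, mlieBracket_swap_apply (V := A), D.couplingForm_swap x _ (B x),
    D.couplingForm_swap x (A x)]
  simp only [map_neg, Pi.neg_apply]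
  ring

include hps

lemma horTensorial_curvatureDefect (k : N → ℝ)
    {B : ∀ x : N, TangentSpace IN x} (hB : IsSmoothVectorField IN B) (x : N) :
    HorTensorial D.Γ x (fun A => D.curvatureDefect k A B x) where
  add A A' hA hA' _ _ := by
    have e : (fun y => D.couplingForm y ((A + A') y) (B y)) =
        (fun y => D.couplingForm y (A y) (B y)) + fun y => D.couplingForm y (A' y) (B y) := by
      ext y; simp
    simp only [curvatureDefect]
    rw [e, derivAlong_add_fun _ (D.isSmoothFunction_couplingForm hps hA hB)
        (D.isSmoothFunction_couplingForm hps hA' hB),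
      mlieBracket_add_left (hA.mdiffAt x) (hA'.mdiffAt x),
      mlieBracket_add_right (hA.mdiffAt x) (hA'.mdiffAt x)]
    simp only [Pi.add_apply, map_add, LinearMap.add_apply]
    ring
  smul f A hf hA hA' := by
    have e : (fun y => D.couplingForm y ((f • A) y) (B y)) =
        f * fun y => D.couplingForm y (A y) (B y) := by
      ext y; simp
    have h1 : mlieBracket IN (f • A) B x
        = -differential IN f x (B x) • A x + f x • mlieBracket IN A B x :=
      mlieBracket_smul_left (hf.mdiffAt x) (hA.mdiffAt x)
    have h2 : mlieBracket IN (hamiltonian IN D.ν k) (f • A) x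
        = derivAlong IN (hamiltonian IN D.ν k) f x • A x
          + f x • mlieBracket IN (hamiltonian IN D.ν k) A x :=
      mlieBracket_smul_right (hf.mdiffAt x) (hA.mdiffAt x)
    simp only [curvatureDefect]
    rw [e, derivAlong_mul_fun _ hf (D.isSmoothFunction_couplingForm hps hA hB), h1, h2]
    simp only [Pi.smul_apply', Pi.add_apply, Pi.mul_apply, map_add, map_smul, LinearMap.add_apply,
      LinearMap.smul_apply, smul_eq_mul, D.Γ.toFun_eq_zero (hA' x), map_zero, mul_zero]
    ring

lemma curvatureDefect_congr (k : N → ℝ) {A B A' B' : ∀ x : N, TangentSpace IN x} {x : N}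
    (hA : IsSmoothVectorField IN A) (hB : IsSmoothVectorField IN B)
    (hA' : IsSmoothVectorField IN A') (hB' : IsSmoothVectorField IN B')
    (a : ∀ y, A y ∈ D.Γ.hor y) (b : ∀ y, B y ∈ D.Γ.hor y) (a' : ∀ y, A' y ∈ D.Γ.hor y)
    (b' : ∀ y, B' y ∈ D.Γ.hor y) (hAA' : A x = A' x) (hBB' : B x = B' x) :
    D.curvatureDefect k A B x = D.curvatureDefect k A' B' x := by
  rw [(D.horTensorial_curvatureDefect hps k hB x).congr hA hA' a a' hAA', D.curvatureDefect_swap,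
    (D.horTensorial_curvatureDefect hps k hA' x).congr hB hB' b b' hBB', ← D.curvatureDefect_swap]

lemma mfderiv_mlieBracket_hamiltonian_lift {k : N → ℝ} (hk : IsSmoothFunction IN k)
    {X : ∀ s : S, TangentSpace IS s} (hX : IsSmoothVectorField IS X) (x : N) :
    mfderiv IN IS p x (mlieBracket IN (hamiltonian IN D.ν k) (D.Γ.lift hp X) x) = 0 := by
  have h0 : IsSmoothVectorField IS (0 : ∀ s : S, TangentSpace IS s) :=
    contMDiff_zeroSection ℝ (TangentSpace IS : S → Type _)
  rw [mfderiv_mlieBracket hps (D.isBivectorField_ν.isSmoothVectorField_hamiltonian hk)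
    (D.Γ.isSmoothVectorField_lift hp hps hX) h0 hX (fun y => D.ν_mem_vert y _)
    (D.Γ.mfderiv_lift hp X), mlieBracket_zero_left]
  rfl

lemma curv_mem_vert {X Y : ∀ s : S, TangentSpace IS s} (hX : IsSmoothVectorField IS X)
    (hY : IsSmoothVectorField IS Y) (x : N) : D.Γ.curv hp X Y x ∈ vert IN IS p x := by
  change mfderiv IN IS p x (mlieBracket IN (D.Γ.lift hp X) (D.Γ.lift hp Y) x
    - D.Γ.lift hp (mlieBracket IS X Y) x) = 0
  rw [map_sub, D.Γ.mfderiv_lift, sub_eq_zero]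
  exact mfderiv_mlieBracket hps (D.Γ.isSmoothVectorField_lift hp hps hX)
    (D.Γ.isSmoothVectorField_lift hp hps hY) hX hY (D.Γ.mfderiv_lift hp X)
    (D.Γ.mfderiv_lift hp Y) x

lemma toFun_mlieBracket_lift {X Y : ∀ s : S, TangentSpace IS s} (hX : IsSmoothVectorField IS X)
    (hY : IsSmoothVectorField IS Y) (x : N) :
    D.Γ.toFun x (mlieBracket IN (D.Γ.lift hp X) (D.Γ.lift hp Y) x) = D.Γ.curv hp X Y x := by
  have h := D.Γ.apply_of_mem x _ (D.curv_mem_vert hp hps hX hY x)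
  rw [← h]
  simp only [EhresmannConnection.curv]
  rw [map_sub, D.Γ.toFun_eq_zero (D.Γ.lift_mem_hor hp _ x), sub_zero]

lemma curvatureDefect_lift {k : N → ℝ} (hk : IsSmoothFunction IN k)
    {X Y : ∀ s : S, TangentSpace IS s} (hX : IsSmoothVectorField IS X)
    (hY : IsSmoothVectorField IS Y) (x : N) :
    D.curvatureDefect k (D.Γ.lift hp X) (D.Γ.lift hp Y) x
      = differential IN k x (D.Γ.curv hp X Y x) - differential IN k x (D.ν x (differential IN
        (fun y => D.couplingForm y (D.Γ.lift hp X y) (D.Γ.lift hp Y y)) x)) := by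
  simp only [curvatureDefect]
  rw [D.toFun_mlieBracket_lift hp hps hX hY, D.couplingForm_swap x _ (D.Γ.lift hp Y x),
    D.couplingForm_of_mem_vert _ (D.mfderiv_mlieBracket_hamiltonian_lift hp hps hk hX x),
    D.couplingForm_of_mem_vert _ (D.mfderiv_mlieBracket_hamiltonian_lift hp hps hk hY x),
    derivAlong, hamiltonian, D.isBivectorField_ν.apply_swap]
  ring

lemma curvatureDefect_basicField {k : N → ℝ} (hk : IsSmoothFunction IN k) {F G : S → ℝ}
    (hF : IsSmoothFunction IS F) (hG : IsSmoothFunction IS G) (x : N) :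
    D.curvatureDefect k (D.basicField hp F) (D.basicField hp G) x
      = differential IN k x (D.Γ.toFun x
          (mlieBracket IN (D.basicField hp F) (D.basicField hp G) x)
        - D.ν x (differential IN (pairing IN (D.couplingBivector hp) (F ∘ p) (G ∘ p)) x)) := by
  have hV := D.isBivectorField_ν.isSmoothVectorField_hamiltonian hk
  have hV0 : ∀ {A : S → ℝ}, IsSmoothFunction IS A →
      derivAlong IN (hamiltonian IN D.ν k) (A ∘ p) = 0 := fun hA =>
    D.pairing_ν_comp_right hps hA k
  have hbr : ∀ {A B : S → ℝ}, IsSmoothFunction IS A → IsSmoothFunction IS B →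
      D.couplingForm x (D.basicField hp A x)
        (mlieBracket IN (hamiltonian IN D.ν k) (D.basicField hp B) x)
        = derivAlong IN (hamiltonian IN D.ν k)
            (derivAlong IN (D.basicField hp B) (A ∘ p)) x := by
    intro A B hA hB
    rw [D.couplingForm_basicField hp hps hA]
    change derivAlong IN (mlieBracket IN (hamiltonian IN D.ν k) (D.basicField hp B)) (A ∘ p) x = _
    rw [derivAlong_mlieBracket hV (D.isSmoothVectorField_basicField hp hps hB) (hA.comp hps),
      hV0 hA, derivAlong_zero_fun]
    simp
  have e : (fun y => D.couplingForm y (D.basicField hp F y) (D.basicField hp G y))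
      = derivAlong IN (D.basicField hp G) (F ∘ p) := by
    ext y
    exact D.couplingForm_basicField hp hps hF y _
  simp only [curvatureDefect]
  rw [e, D.couplingForm_swap x _ (D.basicField hp G x), hbr hG hF, hbr hF hG,
    D.pairing_couplingBivector_comp hp hps hF, D.derivAlong_basicField_swap hp hps hG hF,
    derivAlong_neg_fun, map_sub, D.isBivectorField_ν.apply_swap]
  simp only [Pi.neg_apply, derivAlong, hamiltonian]
  ring

/-- The curvature identity holds at `x` if and only if the Jacobiator vanishes at `x` on two
functions from the base and a function whose differential at `x` kills the horizontal space. -/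
lemma curv_eq_iff (x : N) :
    (∀ X Y : ∀ s : S, TangentSpace IS s, IsSmoothVectorField IS X → IsSmoothVectorField IS Y →
      D.Γ.curv hp X Y x = D.ν x (differential IN
        (fun y => D.couplingForm y (D.Γ.lift hp X y) (D.Γ.lift hp Y y)) x))
    ↔ ∀ (F G : S → ℝ) (k : N → ℝ), IsSmoothFunction IS F → IsSmoothFunction IS G →
      IsSmoothFunction IN k → D.IsVerticalAt x k →
      jacobiator IN (D.couplingBivector hp) (F ∘ p) (G ∘ p) k x = 0 := by
  have hl : ∀ {X : ∀ s : S, TangentSpace IS s}, IsSmoothVectorField IS X →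
      IsSmoothVectorField IN (D.Γ.lift hp X) := D.Γ.isSmoothVectorField_lift hp hps
  have hb : ∀ {F : S → ℝ}, IsSmoothFunction IS F → IsSmoothVectorField IN (D.basicField hp F) :=
    D.isSmoothVectorField_basicField hp hps
  have hJ : ∀ (F G : S → ℝ) (k : N → ℝ), IsSmoothFunction IS F → IsSmoothFunction IS G →
      IsSmoothFunction IN k → D.IsVerticalAt x k →
      jacobiator IN (D.couplingBivector hp) (F ∘ p) (G ∘ p) k x
        = -D.curvatureDefect k (D.basicField hp F) (D.basicField hp G) x := by
    intro F G k hF hG hk hkx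
    rw [(D.isBivectorField_couplingBivector hp hps).jacobiator_eq_sub_mlieBracket (hF.comp hps)
      (hG.comp hps) hk, D.hamiltonian_couplingBivector_comp hp hps hF,
      D.hamiltonian_couplingBivector_comp hp hps hG, D.curvatureDefect_basicField hp hps hk hF hG]
    have h1 := hkx _ (D.Γ.sub_toFun_mem_hor x
      (mlieBracket IN (D.basicField hp F) (D.basicField hp G) x))
    simp only [hamiltonian, couplingBivector, LinearMap.add_apply, map_add, map_sub] at h1 ⊢
    rw [hkx _ (D.μ_mem_hor hp x _)]
    linarith
  constructor
  · intro h F G k hF hG hk hkx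
    rw [hJ F G k hF hG hk hkx, neg_eq_zero]
    obtain ⟨X, hX, e₁⟩ := D.exists_lift_eq hp (D.basicField_mem_hor hp F x)
    obtain ⟨Y, hY, e₂⟩ := D.exists_lift_eq hp (D.basicField_mem_hor hp G x)
    rw [D.curvatureDefect_congr hps k (hb hF) (hb hG) (hl hX) (hl hY)
      (D.basicField_mem_hor hp F) (D.basicField_mem_hor hp G) (D.Γ.lift_mem_hor hp X)
      (D.Γ.lift_mem_hor hp Y) e₁.symm e₂.symm, D.curvatureDefect_lift hp hps hk hX hY,
      h X Y hX hY, sub_self]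
  · intro h X Y hX hY
    refine eq_of_forall_differential fun k hk => ?_
    rw [← sub_eq_zero, ← D.curvatureDefect_lift hp hps hk hX hY]
    obtain ⟨F, hF, e₁⟩ := D.exists_basicField_eq hp hps (D.Γ.lift_mem_hor hp X x)
    obtain ⟨G, hG, e₂⟩ := D.exists_basicField_eq hp hps (D.Γ.lift_mem_hor hp Y x)
    rw [D.curvatureDefect_congr hps k (hl hX) (hl hY) (hb hF) (hb hG) (D.Γ.lift_mem_hor hp X)
      (D.Γ.lift_mem_hor hp Y) (D.basicField_mem_hor hp F) (D.basicField_mem_hor hp G)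
      e₁.symm e₂.symm]
    -- the defect only sees the part of `k` that is not a function from the base
    obtain ⟨K, k', hK, hk', hkx, rfl⟩ := D.exists_eq_comp_add hp hps x hk
    have h1 := h F G k' hF hG hk' hkx
    rw [hJ F G k' hF hG hk' hkx, neg_eq_zero,
      D.curvatureDefect_basicField hp hps hk' hF hG] at h1
    rw [D.curvatureDefect_basicField hp hps hk hF hG, differential_add (hK.comp hps) hk',
      LinearMap.add_apply, h1, add_zero, differential_comp hps hK, map_sub, D.Γ.mfderiv_toFun,
      show mfderiv IN IS p x (D.ν x _) = 0 from D.ν_mem_vert x _, sub_zero, map_zero]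

end Curvature

/-! ### Invariance of the vertical bivector -/

section Invariance

/-- For functions whose differentials at `x` kill the horizontal space, the Lie derivative of a
vertical bivector along horizontal fields is tensorial in the field. -/
lemma horTensorial_schoutenVector {x : N} {g h : N → ℝ} (hg : IsSmoothFunction IN g)
    (hh : IsSmoothFunction IN h) (hgx : D.IsVerticalAt x g) (hhx : D.IsVerticalAt x h) :
    HorTensorial D.Γ x (fun A => schoutenVector IN A D.ν g h x) where
  add A B hA hB _ _ := by
    simp only [schoutenVector_eq, derivAlong_add]
    rw [pairing_add_left (hg.derivAlong hA) (hg.derivAlong hB),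
      pairing_add_right (hh.derivAlong hA) (hh.derivAlong hB)]
    simp only [Pi.add_apply]
    ring
  smul f A hf hA hA' := by
    have h1 : derivAlong IN A g x = 0 := hgx _ (hA' x)
    have h2 : derivAlong IN A h x = 0 := hhx _ (hA' x)
    simp only [schoutenVector_eq, derivAlong_smul, Pi.mul_apply]
    simp only [pairing]
    rw [differential_mul hf (hg.derivAlong hA), differential_mul hf (hh.derivAlong hA), h1, h2]
    simp only [zero_smul, add_zero, map_smul, LinearMap.smul_apply, smul_eq_mul]
    ring

include hps

lemma schoutenVector_lift_comp {X : ∀ s : S, TangentSpace IS s} (hX : IsSmoothVectorField IS X)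
    {G : S → ℝ} (hG : IsSmoothFunction IS G) (h : N → ℝ) (x : N) :
    schoutenVector IN (D.Γ.lift hp X) D.ν (G ∘ p) h x = 0 := by
  rw [schoutenVector_eq, D.pairing_ν_comp hps hG, D.pairing_ν_comp hps hG,
    derivAlong_comp_of_mfderiv_eq hps (D.Γ.mfderiv_lift hp X) hG,
    D.pairing_ν_comp hps (hG.derivAlong hX), derivAlong_zero_fun]
  simp

/-- If the differentials of `g` and `h` at `x` kill the horizontal space, then the function
`μ(dg, dh)` vanishes to second order at `x`: it is `ω̂(B, A)` for the fields `A = μ dg` and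
`B = μ dh`, which vanish at `x`. -/
lemma differential_pairing_μ_eq_zero {x : N} {g h : N → ℝ} (hg : IsSmoothFunction IN g)
    (hh : IsSmoothFunction IN h) (hgx : D.IsVerticalAt x g) (hhx : D.IsVerticalAt x h)
    (v : TangentSpace IN x) : differential IN (pairing IN (D.μ hp) g h) x v = 0 := by
  have hμ := D.isBivectorField_μ hp hps
  have h0 : ∀ {f : N → ℝ}, D.IsVerticalAt x f → hamiltonian IN (D.μ hp) f x = 0 := by
    intro f hfx
    refine eq_of_forall_differential fun k _ => ?_
    rw [hamiltonian, hμ.apply_swap, hfx _ (D.μ_mem_hor hp x _), map_zero, neg_zero]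
  have hB := hμ.isSmoothVectorField_hamiltonian hh
  have e : pairing IN (D.μ hp) g h = fun y => D.couplingForm y (hamiltonian IN (D.μ hp) h y)
      (hamiltonian IN (D.μ hp) g y) := by
    ext y
    exact D.apply_μ_swap hp y _ _
  rw [e]
  refine tensorial_eq_zero (x := x) (Φ := fun A => differential IN
    (fun y => D.couplingForm y (hamiltonian IN (D.μ hp) h y) (A y)) x v) ?_ ?_
    (hμ.isSmoothVectorField_hamiltonian hg) (h0 hgx)
  · intro A A' hA hA'
    have e1 : (fun y => D.couplingForm y (hamiltonian IN (D.μ hp) h y) ((A + A') y)) =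
        (fun y => D.couplingForm y (hamiltonian IN (D.μ hp) h y) (A y))
          + fun y => D.couplingForm y (hamiltonian IN (D.μ hp) h y) (A' y) := by
      ext y; simp
    simp only [e1]
    rw [differential_add (D.isSmoothFunction_couplingForm hps hB hA)
      (D.isSmoothFunction_couplingForm hps hB hA'), LinearMap.add_apply]
  · intro f A hf hA
    have e1 : (fun y => D.couplingForm y (hamiltonian IN (D.μ hp) h y) ((f • A) y)) =
        f * fun y => D.couplingForm y (hamiltonian IN (D.μ hp) h y) (A y) := by
      ext y; simp
    simp only [e1]
    rw [differential_mul hf (D.isSmoothFunction_couplingForm hps hB hA), h0 hhx]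
    simp

lemma schoutenVector_μ_eq_zero {x : N} {g h : N → ℝ} (hg : IsSmoothFunction IN g)
    (hh : IsSmoothFunction IN h) (hgx : D.IsVerticalAt x g) (hhx : D.IsVerticalAt x h)
    (A : ∀ x : N, TangentSpace IN x) : schoutenVector IN A (D.μ hp) g h x = 0 := by
  rw [schoutenVector_eq, derivAlong, D.differential_pairing_μ_eq_zero hp hps hg hh hgx hhx,
    (D.isBivectorField_μ hp hps).pairing_swap g]
  simp only [Pi.neg_apply, pairing]
  rw [hgx _ (D.μ_mem_hor hp x _), hhx _ (D.μ_mem_hor hp x _)]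
  simp

/-- The vertical bivector is invariant under horizontal lifts at `x` if and only if the Jacobiator
vanishes at `x` on a function from the base and two functions whose differentials at `x` kill the
horizontal space. -/
lemma schoutenVector_lift_iff (x : N) :
    (∀ X : ∀ s : S, TangentSpace IS s, IsSmoothVectorField IS X → ∀ g h : N → ℝ,
      IsSmoothFunction IN g → IsSmoothFunction IN h →
      schoutenVector IN (D.Γ.lift hp X) D.ν g h x = 0)
    ↔ ∀ (F : S → ℝ) (g h : N → ℝ), IsSmoothFunction IS F → IsSmoothFunction IN g →
      IsSmoothFunction IN h → D.IsVerticalAt x g → D.IsVerticalAt x h →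
      jacobiator IN (D.couplingBivector hp) (F ∘ p) g h x = 0 := by
  have hl : ∀ {X : ∀ s : S, TangentSpace IS s}, IsSmoothVectorField IS X →
      IsSmoothVectorField IN (D.Γ.lift hp X) := D.Γ.isSmoothVectorField_lift hp hps
  have hb : ∀ {F : S → ℝ}, IsSmoothFunction IS F → IsSmoothVectorField IN (D.basicField hp F) :=
    D.isSmoothVectorField_basicField hp hps
  have hJ : ∀ (F : S → ℝ) (g h : N → ℝ), IsSmoothFunction IS F → IsSmoothFunction IN g →
      IsSmoothFunction IN h → D.IsVerticalAt x g → D.IsVerticalAt x h →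
      jacobiator IN (D.couplingBivector hp) (F ∘ p) g h x
        = -schoutenVector IN (D.basicField hp F) D.ν g h x := by
    intro F g h hF hg hh hgx hhx
    rw [(D.isBivectorField_couplingBivector hp hps).jacobiator_eq_neg_schoutenVector,
      D.hamiltonian_couplingBivector_comp hp hps hF]
    change -schoutenVector IN _ (fun x => D.μ hp x + D.ν x) g h x = _
    rw [(D.isBivectorField_μ hp hps).schoutenVector_add_bivector D.isBivectorField_ν _ hg hh,
      D.schoutenVector_μ_eq_zero hp hps hg hh hgx hhx, zero_add]
  constructor
  · intro H F g h hF hg hh hgx hhx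
    rw [hJ F g h hF hg hh hgx hhx, neg_eq_zero]
    obtain ⟨X, hX, e⟩ := D.exists_lift_eq hp (D.basicField_mem_hor hp F x)
    rw [(D.horTensorial_schoutenVector hg hh hgx hhx).congr (hb hF) (hl hX)
      (D.basicField_mem_hor hp F) (D.Γ.lift_mem_hor hp X) e.symm]
    exact H X hX g h hg hh
  · intro H X hX g h hg hh
    have hν := D.isBivectorField_ν
    obtain ⟨G, g', hG, hg', hgx, rfl⟩ := D.exists_eq_comp_add hp hps x hg
    obtain ⟨K, h', hK, hh', hhx, rfl⟩ := D.exists_eq_comp_add hp hps x hh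
    rw [hν.schoutenVector_add_left (hl hX) (hG.comp hps) hg' hh,
      D.schoutenVector_lift_comp hp hps hX hG, zero_add, hν.schoutenVector_swap,
      hν.schoutenVector_add_left (hl hX) (hK.comp hps) hh' hg',
      D.schoutenVector_lift_comp hp hps hX hK, zero_add, ← hν.schoutenVector_swap]
    obtain ⟨F, hF, e⟩ := D.exists_basicField_eq hp hps (D.Γ.lift_mem_hor hp X x)
    rw [(D.horTensorial_schoutenVector hg' hh' hgx hhx).congr (hl hX) (hb hF)
      (D.Γ.lift_mem_hor hp X) (D.basicField_mem_hor hp F) e.symm, ← neg_eq_zero,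
      ← hJ F g' h' hF hg' hh' hgx hhx]
    exact H F g' h' hF hg' hh' hgx hhx

end Invariance

/-! ### The vertical Jacobiator -/

section Vertical

include hps

lemma jacobiator_ν_comp {F : S → ℝ} (hF : IsSmoothFunction IS F) (g h : N → ℝ) (x : N) :
    jacobiator IN D.ν (F ∘ p) g h x = 0 := by
  have h0 : hamiltonian IN D.ν (F ∘ p) = 0 := funext fun y => D.ν_differential_comp hps hF y
  rw [D.isBivectorField_ν.jacobiator_eq_neg_schoutenVector, h0, schoutenVector_eq]
  have h1 : ∀ f : N → ℝ, derivAlong IN (0 : ∀ x : N, TangentSpace IN x) f = 0 := fun f => by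
    ext y; simp [derivAlong]
  have h2 : ∀ y, differential IN (0 : N → ℝ) y = 0 := fun y => differential_const (I := IN) 0 y
  simp [h1, h2, pairing]

/-- On functions whose differentials at `x` kill the horizontal space, the Jacobiators of `μ + ν`
and of `ν` agree at `x`. -/
lemma jacobiator_couplingBivector_eq {x : N} {f g h : N → ℝ} (hf : IsSmoothFunction IN f)
    (hg : IsSmoothFunction IN g) (hh : IsSmoothFunction IN h) (hfx : D.IsVerticalAt x f)
    (hgx : D.IsVerticalAt x g) (hhx : D.IsVerticalAt x h) :
    jacobiator IN (D.couplingBivector hp) f g h x = jacobiator IN D.ν f g h x := by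
  have hν := D.isBivectorField_ν
  have hμ := D.isBivectorField_μ hp hps
  have key : ∀ {a b c : N → ℝ}, IsSmoothFunction IN a → IsSmoothFunction IN b →
      D.IsVerticalAt x a → D.IsVerticalAt x b → D.IsVerticalAt x c →
      pairing IN (D.couplingBivector hp) (pairing IN (D.couplingBivector hp) a b) c x
        = pairing IN D.ν (pairing IN D.ν a b) c x := by
    intro a b c ha hb hax hbx hcx
    change pairing IN (fun x => D.μ hp x + D.ν x)
      (pairing IN (fun x => D.μ hp x + D.ν x) a b) c x = _
    rw [pairing_add_bivector, pairing_add_bivector, Pi.add_apply,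
      pairing_add_left (Λ := D.ν) (hμ.isSmoothFunction_pairing ha hb)
        (hν.isSmoothFunction_pairing ha hb), Pi.add_apply, hν.pairing_swap (pairing IN (D.μ hp) a b)]
    simp only [Pi.neg_apply, pairing]
    rw [hcx _ (D.μ_mem_hor hp x _)]
    have h1 := D.differential_pairing_μ_eq_zero hp hps ha hb hax hbx
      (D.ν x (differential IN c x))
    rw [h1]
    ring
  simp only [jacobiator]
  rw [key hf hg hfx hgx hhx, key hg hh hgx hhx hfx, key hh hf hhx hfx hgx]

/-- The Jacobiator of `ν` vanishes at `x` if and only if the Jacobiator of `μ + ν` vanishes at `x`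
on functions whose differentials at `x` kill the horizontal space. -/
lemma jacobiator_ν_iff (x : N) :
    (∀ f g h : N → ℝ, IsSmoothFunction IN f → IsSmoothFunction IN g → IsSmoothFunction IN h →
      jacobiator IN D.ν f g h x = 0)
    ↔ ∀ f g h : N → ℝ, IsSmoothFunction IN f → IsSmoothFunction IN g → IsSmoothFunction IN h →
      D.IsVerticalAt x f → D.IsVerticalAt x g → D.IsVerticalAt x h →
      jacobiator IN (D.couplingBivector hp) f g h x = 0 := by
  constructor
  · intro H f g h hf hg hh hfx hgx hhx
    rw [D.jacobiator_couplingBivector_eq hp hps hf hg hh hfx hgx hhx]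
    exact H f g h hf hg hh
  · intro H f g h hf hg hh
    have hν := D.isBivectorField_ν
    obtain ⟨F, f', hF, hf', hfx, rfl⟩ := D.exists_eq_comp_add hp hps x hf
    obtain ⟨G, g', hG, hg', hgx, rfl⟩ := D.exists_eq_comp_add hp hps x hg
    obtain ⟨K, h', hK, hh', hhx, rfl⟩ := D.exists_eq_comp_add hp hps x hh
    rw [hν.jacobiator_add (hF.comp hps) hf' hg hh, D.jacobiator_ν_comp hps hF, zero_add,
      jacobiator_rotate, hν.jacobiator_add (hG.comp hps) hg' hh hf', D.jacobiator_ν_comp hps hG,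
      zero_add, jacobiator_rotate, hν.jacobiator_add (hK.comp hps) hh' hf' hg',
      D.jacobiator_ν_comp hps hK, zero_add, jacobiator_rotate,
      ← D.jacobiator_couplingBivector_eq hp hps hf' hg' hh' hfx hgx hhx]
    exact H f' g' h' hf' hg' hh' hfx hgx hhx

end Vertical

/-! ### The four conditions -/

section Main

include hps

/-- By trilinearity and antisymmetry, the Jacobiator vanishes at `x` if it vanishes on functions
each of which is from the base or has a differential that kills the horizontal space at `x`. -/
lemma jacobiator_eq_zero_of_split {x : N}
    (h₀ : ∀ F G K : S → ℝ, IsSmoothFunction IS F → IsSmoothFunction IS G →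
      IsSmoothFunction IS K → jacobiator IN (D.couplingBivector hp) (F ∘ p) (G ∘ p) (K ∘ p) x = 0)
    (h₁ : ∀ (F G : S → ℝ) (k : N → ℝ), IsSmoothFunction IS F → IsSmoothFunction IS G →
      IsSmoothFunction IN k → D.IsVerticalAt x k →
      jacobiator IN (D.couplingBivector hp) (F ∘ p) (G ∘ p) k x = 0)
    (h₂ : ∀ (F : S → ℝ) (g h : N → ℝ), IsSmoothFunction IS F → IsSmoothFunction IN g →
      IsSmoothFunction IN h → D.IsVerticalAt x g → D.IsVerticalAt x h →
      jacobiator IN (D.couplingBivector hp) (F ∘ p) g h x = 0)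
    (h₃ : ∀ f g h : N → ℝ, IsSmoothFunction IN f → IsSmoothFunction IN g →
      IsSmoothFunction IN h → D.IsVerticalAt x f → D.IsVerticalAt x g → D.IsVerticalAt x h →
      jacobiator IN (D.couplingBivector hp) f g h x = 0)
    {f g h : N → ℝ} (hf : IsSmoothFunction IN f) (hg : IsSmoothFunction IN g)
    (hh : IsSmoothFunction IN h) : jacobiator IN (D.couplingBivector hp) f g h x = 0 := by
  have hπ := D.isBivectorField_couplingBivector hp hps
  -- two functions from the base and an arbitrary one
  have a₁ : ∀ (F G : S → ℝ) (k : N → ℝ), IsSmoothFunction IS F → IsSmoothFunction IS G →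
      IsSmoothFunction IN k → jacobiator IN (D.couplingBivector hp) (F ∘ p) (G ∘ p) k x = 0 := by
    intro F G k hF hG hk
    obtain ⟨K, k', hK, hk', hkx, rfl⟩ := D.exists_eq_comp_add hp hps x hk
    rw [jacobiator_rotate, jacobiator_rotate,
      hπ.jacobiator_add (hK.comp hps) hk' (hF.comp hps) (hG.comp hps), jacobiator_rotate,
      h₀ F G K hF hG hK, jacobiator_rotate, h₁ F G k' hF hG hk' hkx, add_zero]
  -- a function from the base and two arbitrary ones
  have a₂ : ∀ (F : S → ℝ) (g h : N → ℝ), IsSmoothFunction IS F → IsSmoothFunction IN g →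
      IsSmoothFunction IN h → jacobiator IN (D.couplingBivector hp) (F ∘ p) g h x = 0 := by
    intro F g h hF hg hh
    obtain ⟨G, g', hG, hg', hgx, rfl⟩ := D.exists_eq_comp_add hp hps x hg
    obtain ⟨K, h', hK, hh', hhx, rfl⟩ := D.exists_eq_comp_add hp hps x hh
    rw [jacobiator_rotate, hπ.jacobiator_add (hG.comp hps) hg' hh (hF.comp hps),
      ← jacobiator_rotate (F ∘ p) (G ∘ p), a₁ F G _ hF hG hh, zero_add, jacobiator_rotate,
      hπ.jacobiator_add (hK.comp hps) hh' (hF.comp hps) hg', a₁ K F g' hK hF hg', zero_add,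
      jacobiator_rotate]
    exact h₂ F g' h' hF hg' hh' hgx hhx
  obtain ⟨F, f', hF, hf', hfx, rfl⟩ := D.exists_eq_comp_add hp hps x hf
  obtain ⟨G, g', hG, hg', hgx, rfl⟩ := D.exists_eq_comp_add hp hps x hg
  obtain ⟨K, h', hK, hh', hhx, rfl⟩ := D.exists_eq_comp_add hp hps x hh
  rw [hπ.jacobiator_add (hF.comp hps) hf' hg hh, a₂ F _ _ hF hg hh, zero_add, jacobiator_rotate,
    hπ.jacobiator_add (hG.comp hps) hg' hh hf', a₂ G _ _ hG hh hf', zero_add, jacobiator_rotate,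
    hπ.jacobiator_add (hK.comp hps) hh' hf' hg', a₂ K _ _ hK hf' hg', zero_add, jacobiator_rotate]
  exact h₃ f' g' h' hf' hg' hh' hfx hgx hhx

/-- The characterization of Poisson bivectors `μ + ν` for an arbitrary smooth submersion `p`. -/
theorem isPoisson_couplingBivector_iff :
    IsPoisson IN (D.couplingBivector hp) ↔
      IsPoisson IN D.ν ∧
      (∀ X : ∀ s : S, TangentSpace IS s, IsSmoothVectorField IS X → ∀ f g : N → ℝ,
        IsSmoothFunction IN f → IsSmoothFunction IN g → ∀ x,
          schoutenVector IN (D.Γ.lift hp X) D.ν f g x = 0) ∧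
      (∀ X Y : ∀ s : S, TangentSpace IS s, IsSmoothVectorField IS X → IsSmoothVectorField IS Y →
        ∀ x : N, D.Γ.curv hp X Y x = D.ν x (differential IN
          (fun y => D.couplingForm y (D.Γ.lift hp X y) (D.Γ.lift hp Y y)) x)) ∧
      (∀ X₁ X₂ X₃ : ∀ s : S, TangentSpace IS s, IsSmoothVectorField IS X₁ →
        IsSmoothVectorField IS X₂ → IsSmoothVectorField IS X₃ → ∀ x : N,
          extDerivTwoForm IN D.couplingForm (D.Γ.lift hp X₁) (D.Γ.lift hp X₂)
            (D.Γ.lift hp X₃) x = 0) := by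
  constructor
  · intro hP
    have hJ : ∀ {f g h : N → ℝ} {x : N}, IsSmoothFunction IN f → IsSmoothFunction IN g →
        IsSmoothFunction IN h → jacobiator IN (D.couplingBivector hp) f g h x = 0 := by
      intro f g h x hf hg hh
      have := hP.schouten_self f g h hf hg hh x
      rw [schouten_self_eq] at this
      linarith
    refine ⟨⟨D.isBivectorField_ν, fun f g h hf hg hh x => ?_⟩, fun X hX f g hf hg x => ?_,
      fun X Y hX hY x => ?_, fun X₁ X₂ X₃ h₁ h₂ h₃ x => ?_⟩
    · rw [schouten_self_eq, (D.jacobiator_ν_iff hp hps x).2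
        (fun f g h hf hg hh _ _ _ => hJ hf hg hh) f g h hf hg hh, mul_zero]
    · exact (D.schoutenVector_lift_iff hp hps x).2
        (fun F g h hF hg hh _ _ => hJ (hF.comp hps) hg hh) X hX f g hf hg
    · exact (D.curv_eq_iff hp hps x).2
        (fun F G k hF hG hk _ => hJ (hF.comp hps) (hG.comp hps) hk) X Y hX hY
    · exact (D.extDeriv_lift_iff hp hps x).2
        (fun F G K hF hG hK => hJ (hF.comp hps) (hG.comp hps) (hK.comp hps)) X₁ X₂ X₃ h₁ h₂ h₃
  · rintro ⟨h₁, h₂, h₃, h₄⟩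
    refine ⟨D.isBivectorField_couplingBivector hp hps, fun f g h hf hg hh x => ?_⟩
    rw [schouten_self_eq, D.jacobiator_eq_zero_of_split hp hps
      ((D.extDeriv_lift_iff hp hps x).1 fun X₁ X₂ X₃ k₁ k₂ k₃ => h₄ X₁ X₂ X₃ k₁ k₂ k₃ x)
      ((D.curv_eq_iff hp hps x).1 fun X Y hX hY => h₃ X Y hX hY x)
      ((D.schoutenVector_lift_iff hp hps x).1 fun X hX g h hg hh => h₂ X hX g h hg hh x)
      ((D.jacobiator_ν_iff hp hps x).1 fun f g h hf hg hh => ?_) hf hg hh, mul_zero]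
    have := h₁.schouten_self f g h hf hg hh x
    rw [schouten_self_eq] at this
    linarith

end Main

end GeometricData

end GeometricData

end Coupling

end

theorem theorem1
    {EP : Type*} [NormedAddCommGroup EP] [NormedSpace ℝ EP] [FiniteDimensional ℝ EP]
    {HP : Type*} [TopologicalSpace HP] (IP : ModelWithCorners ℝ EP HP) [IP.Boundaryless]
    {P : Type*} [TopologicalSpace P] [T2Space P] [ChartedSpace HP P] [IsManifold IP ∞ P]
    {ES : Type*} [NormedAddCommGroup ES] [NormedSpace ℝ ES] [FiniteDimensional ℝ ES]
    {HS : Type*} [TopologicalSpace HS] (IS : ModelWithCorners ℝ ES HS) [IS.Boundaryless]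
    {S : Type*} [TopologicalSpace S] [T2Space S] [ChartedSpace HS S] [IsManifold IS ∞ S]
    (ι : S → P) (_hι : IsSmoothEmbedding IS IP ∞ ι)
    (F : Type*) [NormedAddCommGroup F] [NormedSpace ℝ F] [FiniteDimensional ℝ F]
    (V : S → Type*) [TopologicalSpace (TotalSpace F V)] [∀ s, AddCommGroup (V s)]
    [∀ s, Module ℝ (V s)] [∀ s, TopologicalSpace (V s)] [FiberBundle F V] [VectorBundle ℝ F V]
    [ContMDiffVectorBundle ∞ F V IS]
    (T : Coupling.TubularNeighborhood IP IS F V ι)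
    (Ω : ∀ s : S, LinearMap.BilinForm ℝ (TangentSpace IS s)) (_hΩ : Coupling.IsSymplectic IS Ω)
    (D : Coupling.GeometricData IP IS T.proj T.zero Ω) :
    Coupling.IsPoisson IP (fun x => D.μ T.surjective_mfderiv_proj x + D.ν x) ↔
      Coupling.IsPoisson IP D.ν ∧
      (∀ X : ∀ s : S, TangentSpace IS s, Coupling.IsSmoothVectorField IS X →
        ∀ f g : T.N → ℝ, ContMDiff IP 𝓘(ℝ, ℝ) ∞ f → ContMDiff IP 𝓘(ℝ, ℝ) ∞ g → ∀ x,
          Coupling.schoutenVector IP (D.Γ.lift T.surjective_mfderiv_proj X) D.ν f g x = 0) ∧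
      (∀ X Y : ∀ s : S, TangentSpace IS s, Coupling.IsSmoothVectorField IS X →
        Coupling.IsSmoothVectorField IS Y → ∀ x : T.N,
          D.Γ.curv T.surjective_mfderiv_proj X Y x =
            D.ν x (Coupling.differential IP
              (fun y => D.couplingForm y (D.Γ.lift T.surjective_mfderiv_proj X y)
                (D.Γ.lift T.surjective_mfderiv_proj Y y)) x)) ∧
      (∀ X₁ X₂ X₃ : ∀ s : S, TangentSpace IS s, Coupling.IsSmoothVectorField IS X₁ →
        Coupling.IsSmoothVectorField IS X₂ → Coupling.IsSmoothVectorField IS X₃ → ∀ x : T.N,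
          Coupling.extDerivTwoForm IP D.couplingForm
            (D.Γ.lift T.surjective_mfderiv_proj X₁) (D.Γ.lift T.surjective_mfderiv_proj X₂)
            (D.Γ.lift T.surjective_mfderiv_proj X₃) x = 0) := by
  have hps : ContMDiff IP IS ∞ T.proj :=
    (Bundle.contMDiff_proj V).comp T.isLocalDiffeomorph_j.contMDiff
  exact D.isPoisson_couplingBivector_iff T.surjective_mfderiv_proj hps
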